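/- **Theorem.** Let $b\ge 2$ be an integer, let $\theta,\rho\in[0,1)$ be real numbers with $\theta$ irrational, and set $$\xi_b(\theta,\rho)=(b-1)\sum_{n\ge1}\frac{\lfloor n\theta+\rho\rfloor-\lfloor (n-1)\theta+\rho\rfloor}{b^n},\qquad \xi'_b(\theta,\rho)=(b-1)\sum_{n\ge1}\frac{\lceil n\theta+\rho\rceil-\lceil (n-1)\theta+\rho\rceil}{b^n}.$$ Let $\theta=[0;a_1,a_2,\dots]$ be the continued fraction expansion of $\theta$, with convergents $p_k/q_k$ ($p_0=0$, $q_0=1$), and put $\theta_k=q_k\theta-p_k$. A sequence of non-negative integers $(d_k)_{k\ge1}$ satisfies the *Ostrowski rules* if $d_1\le a_1-1$, $d_k\le a_k$ for $k\ge2$, and, for all $k\ge 1$, $d_k=0$ whenever $d_{k+1}=a_{k+1}$. To $\xi\in\{\xi_b(\theta,\rho),\xi'_b(\theta,\rho)\}$ attach a sequence of digits $(b_k)_{k\ge1}$ as follows. (A) If $\rho\notin\mathbb Z\theta+\mathbb Z$ or $\rho\in\mathbb Z_{\ge1}\theta+\mathbb Z$, then, for both choices of $\xi$, $(b_k)$ is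 the Ostrowski expansion of $\rho-\theta$: it satisfies the Ostrowski rules, $\rho-\theta=\sum_{k\ge1}b_k\theta_{k-1}$, and $b_k<a_k$ for infinitely many odd $k$ and for infinitely many even $k$. (B) Otherwise $\rho-\theta=-m\theta+p$ with integers $m\ge1$ and $p$. Define an integer $l\ge 0$ and two sequences $e,e'$ as follows. If $m=1$ (that is, $\rho=0$), put $l=0$, $e=(a_1-1,0,a_3,0,a_5,\dots)$ and $e'=(0,a_2,0,a_4,\dots)$. If $m\ge2$, define $l$ by $q_l<m\le q_{l+1}$, let $q_{l+1}-m=c_1q_0+\cdots+c_{l+1}q_l$ be the Ostrowski expansion of this integer (that is, $(c_1,\dots,c_{l+1},0,0,\dots)$ satisfies the Ostrowski rules), and put $$e=(c_1,\dots,c_{l+1},0,a_{l+3},0,a_{l+5},\dots),\qquad e'=(c_1,\dots,c_l,c_{l+1}+1,a_{l+2}-1,0,a_{l+4},0,a_{l+6},\dots).$$ For $\xi=\xi_b(\theta,\rho)$ take $(b_k)=e$ if $l$ is odd and $(b_k)=e'$ if $l$ is even; for $\xi=\xi'_b(\theta,\rho)$ take $(b_k)=e'$ if $l$ is odd and $(b_k)=e$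 if $l$ is even. Put $t_k=b_1q_0+b_2q_1+\cdots+b_kq_{k-1}$ (so $t_0=0$), $r_k=q_k-t_k$, and $$\nu_k(1)=2+\frac{t_k}{r_{k+1}},\quad \nu_k(2)=2+\frac{r_k}{r_{k+1}+t_k},\quad \nu_k(3)=1+\frac{q_{k+1}}{r_{k+1}+q_k},\quad \nu_k(4)=1+\frac{r_{k+2}}{q_{k+1}}.$$ Let $\nu(1)$ be the limsup, as $k\to\infty$, of $\nu_k(1)$ over those $k$ with $a_{k+1}-b_{k+1}\ge1$ and $a_{k+2}-b_{k+2}\ge1$; let $\nu(2)$ be the limsup of $\nu_k(2)$ over those $k$ with $a_{k+2}-b_{k+2}\ge1$; and let $\nu(3),\nu(4)$ be the limsups of $\nu_k(3),\nu_k(4)$ over all $k$. These are taken in $[-\infty,+\infty]$, a limsup over a finite set of indices being $-\infty$. Then the digit sequence $(b_k)$ exists, and the irrationality exponent of $\xi$, that is, the supremum in $[-\infty,+\infty]$ of the real numbers $\mu$ such that $|\xi-p/q|<1/q^{\mu}$ has infinitely many solutions in rational numbers $p/q$ (in lowest terms, $q\ge1$), is equal to $$\max\{\nu(1),\nu(2),\nu(3),\nu(4)\}.$$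 This holds for both $\xi=\xi_b(\theta,\rho)$ and $\xi=\xi'_b(\theta,\rho)$. -/

import Mathlib

open Filter

noncomputable section

namespace Sturmian

/-! ### Irrationality exponent -/

/-- The supremum, in the extended reals, of the real numbers `μ` such that `|ζ - p/q| < 1/q^μ`
has infinitely many solutions in rational numbers `p/q`. -/
def irrationalityExponent (ζ : ℝ) : EReal :=
  ⨆ μ ∈ {μ : ℝ | {x : ℚ | |ζ - (x : ℝ)| < 1 / (x.den : ℝ) ^ μ}.Infinite}, (μ : EReal)

/-! ### Sturmian words and Sturmian numbers -/

/-- The `n`-th letter (`n ≥ 1`) of the lower Sturmian word of slope `θ` and intercept `ρ`. -/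
def lowerLetter (θ ρ : ℝ) (n : ℕ) : ℤ := ⌊(n : ℝ) * θ + ρ⌋ - ⌊((n : ℝ) - 1) * θ + ρ⌋

/-- The `n`-th letter (`n ≥ 1`) of the upper Sturmian word of slope `θ` and intercept `ρ`. -/
def upperLetter (θ ρ : ℝ) (n : ℕ) : ℤ := ⌈(n : ℝ) * θ + ρ⌉ - ⌈((n : ℝ) - 1) * θ + ρ⌉

/-- `(b - 1) * ∑_{n ≥ 1} s_n / b ^ n`, with `s_n` the letters of the lower Sturmian word. -/
def xiLower (b : ℕ) (θ ρ : ℝ) : ℝ :=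
  ((b : ℝ) - 1) * ∑' n : ℕ, (lowerLetter θ ρ (n + 1) : ℝ) / (b : ℝ) ^ (n + 1)

/-- `(b - 1) * ∑_{n ≥ 1} s'_n / b ^ n`, with `s'_n` the letters of the upper Sturmian word. -/
def xiUpper (b : ℕ) (θ ρ : ℝ) : ℝ :=
  ((b : ℝ) - 1) * ∑' n : ℕ, (upperLetter θ ρ (n + 1) : ℝ) / (b : ℝ) ^ (n + 1)

/-! ### Continued fraction of the slope -/

/-- The partial quotient `a_k`, `k ≥ 1`, of `θ = [0; a_1, a_2, …]` (the value at `k = 0` is never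
used). -/
def pq (θ : ℝ) (k : ℕ) : ℕ := ⌊((GenContFract.of θ).partDens.get? (k - 1)).getD 0⌋₊

/-- The denominators `q_k` of the convergents of `[0; a_1, a_2, …]`. -/
def qd (θ : ℝ) : ℕ → ℕ
  | 0 => 1
  | 1 => pq θ 1
  | k + 2 => pq θ (k + 2) * qd θ (k + 1) + qd θ k

/-- The numerators `p_k` of the convergents of `[0; a_1, a_2, …]`. -/
def pn (θ : ℝ) : ℕ → ℕ
  | 0 => 0
  | 1 => 1
  | k + 2 => pq θ (k + 2) * pn θ (k + 1) + pn θ k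

/-- `θ_k = q_k θ - p_k`. -/
def thetaSeq (θ : ℝ) (k : ℕ) : ℝ := (qd θ k : ℝ) * θ - (pn θ k : ℝ)

/-! ### Ostrowski numeration

Digit sequences are indexed by `k ≥ 1`; the entry at `0` of `d : ℕ → ℕ` is ignored. -/

/-- The Ostrowski numeration rules in base `θ`. -/
structure OstrowskiRules (θ : ℝ) (d : ℕ → ℕ) : Prop where
  first : d 1 < pq θ 1
  le : ∀ k, 2 ≤ k → d k ≤ pq θ k
  zero : ∀ k, 1 ≤ k → d (k + 1) = pq θ (k + 1) → d k = 0

/-- `d` is the Ostrowski expansion `σ = ∑_{k ≥ 1} d_k θ_{k-1}` of the real number `σ`. -/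
structure IsOstrowskiExpansion (θ σ : ℝ) (d : ℕ → ℕ) : Prop extends OstrowskiRules θ d where
  hasSum : HasSum (fun k : ℕ => (d (k + 1) : ℝ) * thetaSeq θ k) σ
  odd : {k : ℕ | Odd k ∧ d k < pq θ k}.Infinite
  even : {k : ℕ | Even k ∧ d k < pq θ k}.Infinite

/-- `N = d_1 q_0 + ⋯ + d_n q_{n-1}` is the Ostrowski expansion of the natural number `N` in
base `θ`, padded by zeros. -/
structure IsOstrowskiNat (θ : ℝ) (N n : ℕ) (d : ℕ → ℕ) : Prop extends OstrowskiRules θ d where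
  zero_of_lt : ∀ k, n < k → d k = 0
  sum_eq : N = ∑ j ∈ Finset.range n, d (j + 1) * qd θ j

/-! ### The digits attached to a Sturmian word -/

/-- `ρ ∉ ℤθ + ℤ`, or `ρ ∈ ℤ_{≥1}θ + ℤ`. -/
def IsRegularIntercept (θ ρ : ℝ) : Prop :=
  (¬ ∃ m p : ℤ, ρ = m * θ + p) ∨ ∃ m p : ℤ, 1 ≤ m ∧ ρ = m * θ + p

/-- The digits `c_1, …, c_{l+1}, 0, a_{l+3}, 0, a_{l+5}, …`. -/
def tailDigits (θ : ℝ) (l : ℕ) (c : ℕ → ℕ) (k : ℕ) : ℕ :=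
  if k ≤ l + 1 then c k else if Even (k - l) then 0 else pq θ k

/-- The digits `c_1, …, c_l, c_{l+1} + 1, a_{l+2} - 1, 0, a_{l+4}, 0, a_{l+6}, …`. -/
def tailDigits' (θ : ℝ) (l : ℕ) (c : ℕ → ℕ) (k : ℕ) : ℕ :=
  if k ≤ l then c k else if k = l + 1 then c k + 1 else if k = l + 2 then pq θ k - 1
  else if Even (k - l) then pq θ k else 0

/-- The digits `a_1 - 1, 0, a_3, 0, a_5, …`. -/
def zeroDigits (θ : ℝ) (k : ℕ) : ℕ :=
  if k = 1 then pq θ 1 - 1 else if Even k then 0 else pq θ k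

/-- The digits `0, a_2, 0, a_4, …`. -/
def zeroDigits' (θ : ℝ) (k : ℕ) : ℕ := if Even k then pq θ k else 0

/-- When `ρ - θ = -mθ + p` with `m ≥ 1`: the index `l` and the two digit sequences of `ρ - θ`. -/
inductive IsDigitPair (θ ρ : ℝ) : ℕ → (ℕ → ℕ) → (ℕ → ℕ) → Prop
  | zero (hρ : ρ = 0) : IsDigitPair θ ρ 0 (zeroDigits θ) (zeroDigits' θ)
  | pos (m : ℕ) (p : ℤ) (l : ℕ) (c : ℕ → ℕ) (hm : 2 ≤ m) (hρ : ρ - θ = -(m : ℝ) * θ + p)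
      (hl : qd θ l < m) (hl' : m ≤ qd θ (l + 1))
      (hc : IsOstrowskiNat θ (qd θ (l + 1) - m) (l + 1) c) :
      IsDigitPair θ ρ l (tailDigits θ l c) (tailDigits' θ l c)

/-- `d` is the digit sequence attached to the lower Sturmian word of slope `θ`, intercept `ρ`. -/
def IsLowerDigits (θ ρ : ℝ) (d : ℕ → ℕ) : Prop :=
  (IsRegularIntercept θ ρ ∧ IsOstrowskiExpansion θ (ρ - θ) d) ∨
  ∃ l e e', IsDigitPair θ ρ l e e' ∧ ((Odd l ∧ d = e) ∨ (Even l ∧ d = e'))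

/-- `d` is the digit sequence attached to the upper Sturmian word of slope `θ`, intercept `ρ`. -/
def IsUpperDigits (θ ρ : ℝ) (d : ℕ → ℕ) : Prop :=
  (IsRegularIntercept θ ρ ∧ IsOstrowskiExpansion θ (ρ - θ) d) ∨
  ∃ l e e', IsDigitPair θ ρ l e e' ∧ ((Odd l ∧ d = e') ∨ (Even l ∧ d = e))

/-! ### The quantities `ν(1), …, ν(4)` -/

/-- `t_k = d_1 q_0 + ⋯ + d_k q_{k-1}`. -/
def tk (θ : ℝ) (d : ℕ → ℕ) (k : ℕ) : ℕ := ∑ j ∈ Finset.range k, d (j + 1) * qd θ j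

/-- `r_k = q_k - t_k`. -/
def rk (θ : ℝ) (d : ℕ → ℕ) (k : ℕ) : ℤ := (qd θ k : ℤ) - (tk θ d k : ℤ)

/-- `ν_k(1) = 2 + t_k / r_{k+1}`. -/
def nuSeq₁ (θ : ℝ) (d : ℕ → ℕ) (k : ℕ) : ℝ := 2 + (tk θ d k : ℝ) / (rk θ d (k + 1) : ℝ)

/-- `ν_k(2) = 2 + r_k / (r_{k+1} + t_k)`. -/
def nuSeq₂ (θ : ℝ) (d : ℕ → ℕ) (k : ℕ) : ℝ :=
  2 + (rk θ d k : ℝ) / ((rk θ d (k + 1) : ℝ) + (tk θ d k : ℝ))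

/-- `ν_k(3) = 1 + q_{k+1} / (r_{k+1} + q_k)`. -/
def nuSeq₃ (θ : ℝ) (d : ℕ → ℕ) (k : ℕ) : ℝ :=
  1 + (qd θ (k + 1) : ℝ) / ((rk θ d (k + 1) : ℝ) + (qd θ k : ℝ))

/-- `ν_k(4) = 1 + r_{k+2} / q_{k+1}`. -/
def nuSeq₄ (θ : ℝ) (d : ℕ → ℕ) (k : ℕ) : ℝ :=
  1 + (rk θ d (k + 2) : ℝ) / (qd θ (k + 1) : ℝ)

/-- `ν(1)`: the upper limit of `ν_k(1)` along the `k` with `a_{k+1} - d_{k+1} ≥ 1` and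
`a_{k+2} - d_{k+2} ≥ 1` (it is `⊥` if there are only finitely many such `k`). -/
def nu₁ (θ : ℝ) (d : ℕ → ℕ) : EReal :=
  limsup (fun k => (nuSeq₁ θ d k : EReal))
    (atTop ⊓ 𝓟 {k | 1 ≤ (pq θ (k + 1) : ℤ) - d (k + 1) ∧ 1 ≤ (pq θ (k + 2) : ℤ) - d (k + 2)})

/-- `ν(2)`: the upper limit of `ν_k(2)` along the `k` with `a_{k+2} - d_{k+2} ≥ 1`. -/
def nu₂ (θ : ℝ) (d : ℕ → ℕ) : EReal :=
  limsup (fun k => (nuSeq₂ θ d k : EReal))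
    (atTop ⊓ 𝓟 {k | 1 ≤ (pq θ (k + 2) : ℤ) - d (k + 2)})

/-- `ν(3)`, the upper limit of `ν_k(3)`. -/
def nu₃ (θ : ℝ) (d : ℕ → ℕ) : EReal := limsup (fun k => (nuSeq₃ θ d k : EReal)) atTop

/-- `ν(4)`, the upper limit of `ν_k(4)`. -/
def nu₄ (θ : ℝ) (d : ℕ → ℕ) : EReal := limsup (fun k => (nuSeq₄ θ d k : EReal)) atTop

end Sturmian

end

/-!
The argument is arithmetic, with no combinatorics on words. Put `σ = ρ - θ`. The number is
`(b - 1) ∑ (F_n - F_{n-1}) / b^n`, where `F_n` is a rounding `Φ` of `(n + 1) θ + σ`: the floor for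
the lower word and the ceiling minus one for the upper word (`IsRounding`).

If `Nθ - P` is small, then the defect `F_{n+N} - F_n - P` takes only the values `0` and `s`, for a
fixed sign `s`, and it is nonzero exactly when the translation by `Nθ - P` takes the point
`(n + 1) θ + σ` across an integer. Summing by parts, a stretch `r ≤ n < L` without a crossing
yields a fraction of denominator about `b^(r+N)` at a distance of order `b^(-N-L)` from the number,
and this order is exact if there is a crossing at `L`, since all the defects have the same sign
(`exists_fraction_near`). The irrationality exponent is thus a matter of the crossing times of the
orbit of `σ`, for the periods given by the convergents and the semiconvergents of `θ`.

These times are read off the digits. The sum of the Ostrowski expansion shows that the orbit at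
time `r_k` is at a point `y_k` that is close to `0`, on the side `(-1)^k` (`IsCoding`); in the
exceptional case, `y_k = 0` for every other `k`, and the parity of `l` is what puts this zero on the
right side for the rounding at hand (`IsBoundary.exists_isCoding`). The one-sided best approximation
property `not_mem_gap` shows that no crossing occurs between the expected ones. There result four
families of approximations, with denominator `b^D` and error `b^(-D-E)`, where `(D, E)` is

* `(r_{k+1}, r_{k+1} + t_k)` (`IsCoding.sharp_short`),
* `(r_{k+1} + t_k, r_{k+1} + q_k)` (`IsCoding.sharp_long`),
* `(r_{k+1} + q_k, q_{k+1})` (`IsCoding.sharp_preperiodic`),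
* `(q_{k+1}, r_{k+2})` (`IsCoding.sharp_convergent`),

so that `ν_k(i)` is the ratio `1 + E / D` of the `i`-th family. Hence the exponent is at least the
four upper limits. Conversely, the intervals `[D, E]` of those approximations whose error has the
exact order cover all the large integers (`IsCoding.exists_sharp_cover`), and a fraction of
denominator about `b^N` with `D ≤ N ≤ E` is either equal to the approximation of quality `(D, E)`
or far from it, so that the exponent is at most the maximum of the upper limits
(`irrationalityExponent_le`).

Existence of the digits: in the regular case, a greedy algorithm (`greedyDigit`) produces an
expansion, which can break the Ostrowski rules only at a tie, and a tie would put `σ` into the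
backward orbit `{g - mθ | m ≥ 1}` of the origin.
-/

namespace Sturmian

/-! ### The continued fraction of the slope -/

/-- The iterates `θ, {1/θ}, …` of the Gauss map. -/
noncomputable def gaussIter (θ : ℝ) : ℕ → ℝ
  | 0 => θ
  | k + 1 => Int.fract (gaussIter θ k)⁻¹

theorem irrational_gaussIter {θ : ℝ} (hθ : Irrational θ) : ∀ k, Irrational (gaussIter θ k)
  | 0 => hθ
  | k + 1 => by
    have h := (irrational_gaussIter hθ k).inv
    exact h.sub_intCast ⌊(gaussIter θ k)⁻¹⌋

theorem gaussIter_mem {θ : ℝ} (hθ : Irrational θ) (h0 : 0 ≤ θ) (h1 : θ < 1) (k : ℕ) :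
    0 < gaussIter θ k ∧ gaussIter θ k < 1 := by
  have hne := (irrational_gaussIter hθ k).ne_zero
  cases k with
  | zero => exact ⟨lt_of_le_of_ne h0 (Ne.symm hne), h1⟩
  | succ k => exact ⟨lt_of_le_of_ne (Int.fract_nonneg _) (Ne.symm hne), Int.fract_lt_one _⟩

theorem stream_eq_gaussIter {θ : ℝ} (hθ : Irrational θ) (h0 : 0 ≤ θ) (h1 : θ < 1) (k : ℕ) :
    ∃ z : ℤ, GenContFract.IntFractPair.stream θ k = some ⟨z, gaussIter θ k⟩ := by
  induction k with
  | zero => exact ⟨⌊θ⌋, by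
      rw [GenContFract.IntFractPair.stream_zero, GenContFract.IntFractPair.of, gaussIter,
        Int.fract_eq_self.2 ⟨h0, h1⟩]⟩
  | succ k ih =>
    obtain ⟨z, hz⟩ := ih
    exact ⟨⌊(gaussIter θ k)⁻¹⌋,
      GenContFract.IntFractPair.stream_succ_of_some hz (irrational_gaussIter hθ k).ne_zero⟩

theorem pq_succ {θ : ℝ} (hθ : Irrational θ) (h0 : 0 ≤ θ) (h1 : θ < 1) (k : ℕ) :
    pq θ (k + 1) = ⌊(gaussIter θ k)⁻¹⌋₊ := by
  obtain ⟨z, hz⟩ := stream_eq_gaussIter hθ h0 h1 k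
  have h := GenContFract.get?_of_eq_some_of_succ_get?_intFractPair_stream
    (GenContFract.IntFractPair.stream_succ_of_some hz (irrational_gaussIter hθ k).ne_zero)
  have h2 := GenContFract.partDen_eq_s_b h
  simp only [pq, Nat.add_sub_cancel, h2, Option.getD_some, GenContFract.IntFractPair.of]
  rw [← Int.floor_toNat, Int.floor_intCast, Int.floor_toNat]

theorem pq_pos {θ : ℝ} (hθ : Irrational θ) (h0 : 0 ≤ θ) (h1 : θ < 1) (k : ℕ) :
    1 ≤ pq θ (k + 1) := by
  rw [pq_succ hθ h0 h1, Nat.one_le_floor_iff]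
  obtain ⟨h, h'⟩ := gaussIter_mem hθ h0 h1 k
  exact (one_le_inv₀ h).2 h'.le

theorem inv_gaussIter {θ : ℝ} (hθ : Irrational θ) (h0 : 0 ≤ θ) (h1 : θ < 1) (k : ℕ) :
    (gaussIter θ k)⁻¹ = pq θ (k + 1) + gaussIter θ (k + 1) := by
  have h := (gaussIter_mem hθ h0 h1 k).1
  rw [pq_succ hθ h0 h1, gaussIter, Int.fract,
    natCast_floor_eq_intCast_floor (inv_nonneg.2 h.le)]
  ring

/-- The distance `|θ_k|` from `q_k θ` to the nearest integer, as `(-1)^k θ_k`. -/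
noncomputable def tau (θ : ℝ) (k : ℕ) : ℝ := (-1) ^ k * thetaSeq θ k

theorem thetaSeq_eq (θ : ℝ) (k : ℕ) : thetaSeq θ k = (-1) ^ k * tau θ k := by
  rw [tau, ← mul_assoc, ← mul_pow]; simp

theorem thetaSeq_rec (θ : ℝ) (k : ℕ) :
    thetaSeq θ (k + 2) = pq θ (k + 2) * thetaSeq θ (k + 1) + thetaSeq θ k := by
  simp only [thetaSeq, qd, pn]; push_cast; ring

theorem tau_rec (θ : ℝ) (k : ℕ) : tau θ k = pq θ (k + 2) * tau θ (k + 1) + tau θ (k + 2) := by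
  simp only [tau, thetaSeq_rec, pow_succ]; ring

theorem tau_zero (θ : ℝ) : tau θ 0 = θ := by simp [tau, thetaSeq, qd, pn]

theorem tau_one (θ : ℝ) : 1 = pq θ 1 * tau θ 0 + tau θ 1 := by
  simp [tau, thetaSeq, qd, pn]

theorem tau_succ_eq {θ : ℝ} (hθ : Irrational θ) (h0 : 0 ≤ θ) (h1 : θ < 1) (k : ℕ) :
    tau θ (k + 1) = gaussIter θ (k + 1) * tau θ k := by
  induction k with
  | zero =>
    have h := inv_gaussIter hθ h0 h1 0
    have hne : gaussIter θ 0 ≠ 0 := (gaussIter_mem hθ h0 h1 0).1.ne'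
    have h2 := tau_one θ
    rw [tau_zero] at *
    rw [show gaussIter θ 0 = θ from rfl] at *
    have h3 : gaussIter θ (0 + 1) = θ⁻¹ - pq θ (0 + 1) := by linarith
    rw [h3]; field_simp
    simp only [zero_add] at *
    linarith
  | succ k ih =>
    have h := inv_gaussIter hθ h0 h1 (k + 1)
    have hne : gaussIter θ (k + 1) ≠ 0 := (gaussIter_mem hθ h0 h1 (k + 1)).1.ne'
    have h2 := tau_rec θ k
    have h3 : tau θ k = (gaussIter θ (k + 1))⁻¹ * tau θ (k + 1) := by
      rw [ih]; field_simp
    rw [h] at h3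
    simp only [add_assoc, Nat.reduceAdd] at *
    linarith

theorem tau_pos {θ : ℝ} (hθ : Irrational θ) (h0 : 0 ≤ θ) (h1 : θ < 1) (k : ℕ) :
    0 < tau θ k := by
  induction k with
  | zero => rw [tau_zero]; exact (gaussIter_mem hθ h0 h1 0).1
  | succ k ih => rw [tau_succ_eq hθ h0 h1]; exact mul_pos (gaussIter_mem hθ h0 h1 _).1 ih

theorem tau_succ_lt {θ : ℝ} (hθ : Irrational θ) (h0 : 0 ≤ θ) (h1 : θ < 1) (k : ℕ) :
    tau θ (k + 1) < tau θ k := by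
  rw [tau_succ_eq hθ h0 h1]
  nlinarith [(gaussIter_mem hθ h0 h1 (k + 1)).2, tau_pos hθ h0 h1 k]

theorem tau_lt_one {θ : ℝ} (hθ : Irrational θ) (h0 : 0 ≤ θ) (h1 : θ < 1) (k : ℕ) :
    tau θ k < 1 := by
  induction k with
  | zero => rwa [tau_zero]
  | succ k ih => exact (tau_succ_lt hθ h0 h1 k).trans ih

theorem tendsto_tau {θ : ℝ} (hθ : Irrational θ) (h0 : 0 ≤ θ) (h1 : θ < 1) :
    Tendsto (tau θ) atTop (nhds 0) := by
  have hle : ∀ k, tau θ (2 * k) ≤ (1 / 2) ^ k := by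
    intro k
    induction k with
    | zero => simpa using (tau_lt_one hθ h0 h1 0).le
    | succ k ih =>
      have h := tau_rec θ (2 * k)
      have h2 := tau_succ_lt hθ h0 h1 (2 * k + 1)
      have h3 := tau_pos hθ h0 h1 (2 * k + 1)
      have h4 : (1 : ℝ) ≤ pq θ (2 * k + 2) := by exact_mod_cast pq_pos hθ h0 h1 (2 * k + 1)
      rw [show 2 * (k + 1) = 2 * k + 1 + 1 by ring, pow_succ]
      nlinarith
  have hanti : Antitone (tau θ) := antitone_nat_of_succ_le fun k => (tau_succ_lt hθ h0 h1 k).le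
  have hev : Tendsto (fun k => tau θ (2 * k)) atTop (nhds 0) :=
    squeeze_zero (fun k => (tau_pos hθ h0 h1 _).le) hle
      (tendsto_pow_atTop_nhds_zero_of_lt_one (by norm_num) (by norm_num))
  refine tendsto_order.2 ⟨fun a ha => Eventually.of_forall fun k =>
    ha.trans (tau_pos hθ h0 h1 k), fun a ha => ?_⟩
  obtain ⟨k, hk⟩ := (hev.eventually_lt_const ha).exists
  exact eventually_atTop.2 ⟨2 * k, fun n hn => (hanti hn).trans_lt hk⟩

theorem qd_pos {θ : ℝ} (hθ : Irrational θ) (h0 : 0 ≤ θ) (h1 : θ < 1) : ∀ k, 1 ≤ qd θ k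
  | 0 => le_rfl
  | 1 => pq_pos hθ h0 h1 0
  | k + 2 => by rw [qd]; have := qd_pos hθ h0 h1 k; omega

theorem qd_add_le {θ : ℝ} (hθ : Irrational θ) (h0 : 0 ≤ θ) (h1 : θ < 1) (k : ℕ) :
    qd θ (k + 1) + qd θ k ≤ qd θ (k + 2) := by
  rw [qd, add_le_add_iff_right]
  exact Nat.le_mul_of_pos_left _ (pq_pos hθ h0 h1 (k + 1))

theorem qd_le_succ {θ : ℝ} (hθ : Irrational θ) (h0 : 0 ≤ θ) (h1 : θ < 1) (k : ℕ) :
    qd θ k ≤ qd θ (k + 1) := by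
  cases k with
  | zero => exact pq_pos hθ h0 h1 0
  | succ k => have := qd_add_le hθ h0 h1 k; simp only [add_assoc, Nat.reduceAdd] at *; omega

theorem monotone_qd {θ : ℝ} (hθ : Irrational θ) (h0 : 0 ≤ θ) (h1 : θ < 1) : Monotone (qd θ) :=
  monotone_nat_of_le_succ (qd_le_succ hθ h0 h1)

theorem le_qd {θ : ℝ} (hθ : Irrational θ) (h0 : 0 ≤ θ) (h1 : θ < 1) (k : ℕ) : k ≤ qd θ k := by
  induction k with
  | zero => omega
  | succ k ih =>
    cases k with
    | zero => exact pq_pos hθ h0 h1 0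
    | succ k =>
      have := qd_add_le hθ h0 h1 k
      have := qd_pos hθ h0 h1 k
      simp only [add_assoc, Nat.reduceAdd] at *; omega

theorem qd_mul_pn_sub (θ : ℝ) (k : ℕ) :
    (qd θ (k + 1) : ℤ) * pn θ k - qd θ k * pn θ (k + 1) = (-1) ^ (k + 1) := by
  induction k with
  | zero => simp [qd, pn]
  | succ k ih =>
    rw [pow_succ, ← ih]
    simp only [qd, pn]; push_cast; ring

/-- A one-sided best approximation property: the points `mθ - g` with `0 < m < (e+1)q_{k+1} + q_k`
avoid the open interval with end points `θ_{k+1}` and `θ_k + eθ_{k+1}`. In the basis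
`θ_k, θ_{k+1}` of `ℤθ + ℤ`, a point of the interval has coordinates that force `m` to be either
nonpositive or large. -/
theorem not_mem_gap {θ : ℝ} (hθ : Irrational θ) (h0 : 0 ≤ θ) (h1 : θ < 1) (k : ℕ) (e : ℕ)
    (m g : ℤ) (hm : 0 < m) (hm' : m < (e + 1) * qd θ (k + 1) + qd θ k)
    (hu : (-1) ^ (k + 1) * (m * θ - g) < tau θ (k + 1))
    (hl : e * tau θ (k + 1) - tau θ k < (-1) ^ (k + 1) * (m * θ - g)) : False := by
  obtain ⟨x, y, hx, hy⟩ : ∃ x y : ℤ, m = x * qd θ (k + 1) + y * qd θ k ∧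
      g = x * pn θ (k + 1) + y * pn θ k := by
    have hd := qd_mul_pn_sub θ k
    have hs : ((-1 : ℤ) ^ (k + 1)) * (-1) ^ (k + 1) = 1 := by rw [← mul_pow]; simp
    refine ⟨(-1) ^ (k + 1) * (m * pn θ k - g * qd θ k),
      (-1) ^ (k + 1) * (g * qd θ (k + 1) - m * pn θ (k + 1)), ?_, ?_⟩
    · calc m = ((-1 : ℤ) ^ (k + 1)) * (-1) ^ (k + 1) * m := by rw [hs, one_mul]
        _ = (-1) ^ (k + 1) * ((qd θ (k + 1) : ℤ) * pn θ k - qd θ k * pn θ (k + 1)) * m := by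
          rw [hd]
        _ = _ := by ring
    · calc g = ((-1 : ℤ) ^ (k + 1)) * (-1) ^ (k + 1) * g := by rw [hs, one_mul]
        _ = (-1) ^ (k + 1) * ((qd θ (k + 1) : ℤ) * pn θ k - qd θ k * pn θ (k + 1)) * g := by
          rw [hd]
        _ = _ := by ring
  have hval : (-1) ^ (k + 1) * ((m : ℝ) * θ - g) = x * tau θ (k + 1) - y * tau θ k := by
    rw [hx, hy]; simp only [tau, thetaSeq, pow_succ]; push_cast; ring
  rw [hval] at hu hl
  have t1 := tau_pos hθ h0 h1 (k + 1)
  have t0 := tau_pos hθ h0 h1 k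
  have q1 : (1 : ℤ) ≤ qd θ (k + 1) := by exact_mod_cast qd_pos hθ h0 h1 (k + 1)
  have q0 : (1 : ℤ) ≤ qd θ k := by exact_mod_cast qd_pos hθ h0 h1 k
  rcases le_or_gt y 0 with h | h
  · have hyR : (y : ℝ) ≤ 0 := by exact_mod_cast h
    have : (x : ℝ) < 1 := by
      by_contra! hc
      nlinarith
    have hx0 : x ≤ 0 := by
      have : x < 1 := by exact_mod_cast this
      omega
    nlinarith
  · have hyR : (1 : ℝ) ≤ y := by exact_mod_cast h
    have : (e : ℝ) < x := by
      by_contra! hc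
      nlinarith
    have hx0 : (e : ℤ) + 1 ≤ x := by
      have : (e : ℤ) < x := by exact_mod_cast this
      omega
    nlinarith

end Sturmian

namespace Sturmian

/-! ### Rational approximations from almost periods -/

theorem summable_mul_pow_of_bounded {x : ℝ} (hx : 0 < x) (hx2 : x ≤ 1 / 2) {g : ℕ → ℝ} {C : ℝ}
    (hg : ∀ n, |g n| ≤ C) : Summable fun n => g n * x ^ (n + 1) := by
  have hs : Summable fun n : ℕ => C * x ^ (n + 1) :=
    ((summable_nat_add_iff 1).2 (summable_geometric_of_lt_one hx.le (by linarith))).mul_left C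
  refine hs.of_norm_bounded fun n => ?_
  rw [Real.norm_eq_abs, abs_mul, abs_of_pos (pow_pos hx (n + 1))]
  exact mul_le_mul_of_nonneg_right (hg n) (pow_pos hx _).le

/-- A power series with coefficients in `[0, 1]` that vanish below the index `d`. -/
theorem tsum_mul_pow_bounds {x : ℝ} (hx : 0 < x) (hx2 : x ≤ 1 / 2) {g : ℕ → ℝ} (d : ℕ)
    (h0 : ∀ n, 0 ≤ g n) (h1 : ∀ n, g n ≤ 1) (hd : ∀ n < d, g n = 0) :
    0 ≤ (1 - x) * ∑' n, g n * x ^ (n + 1) ∧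
    (1 - x) * ∑' n, g n * x ^ (n + 1) ≤ x ^ (d + 1) ∧
    (g d = 1 → x ^ (d + 2) ≤ (1 - x) * ∑' n, g n * x ^ (n + 1)) := by
  have hs : Summable fun n => g n * x ^ (n + 1) :=
    summable_mul_pow_of_bounded hx hx2 (C := 1) fun n => by rw [abs_of_nonneg (h0 n)]; exact h1 n
  have hnn : ∀ n, 0 ≤ g n * x ^ (n + 1) := fun n => mul_nonneg (h0 n) (pow_pos hx _).le
  refine ⟨mul_nonneg (by linarith) (tsum_nonneg hnn), ?_, fun hgd => ?_⟩
  · have hz : ∑ n ∈ Finset.range d, g n * x ^ (n + 1) = 0 :=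
      Finset.sum_eq_zero fun n hn => by rw [hd n (Finset.mem_range.1 hn), zero_mul]
    have hgeo : HasSum (fun n : ℕ => x ^ n * x ^ (d + 1)) ((1 - x)⁻¹ * x ^ (d + 1)) :=
      (hasSum_geometric_of_lt_one hx.le (by linarith)).mul_right _
    have hle : ∑' n, g (n + d) * x ^ (n + d + 1) ≤ (1 - x)⁻¹ * x ^ (d + 1) := by
      rw [← hgeo.tsum_eq]
      refine ((summable_nat_add_iff d).2 hs).tsum_le_tsum (fun n => ?_) hgeo.summable
      rw [← pow_add, ← add_assoc]
      exact (mul_le_mul_of_nonneg_right (h1 _) (pow_pos hx _).le).trans_eq (one_mul _)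
    rw [← hs.sum_add_tsum_nat_add d, hz, zero_add]
    have h1x : 0 < 1 - x := by linarith
    calc _ ≤ (1 - x) * ((1 - x)⁻¹ * x ^ (d + 1)) := mul_le_mul_of_nonneg_left hle h1x.le
      _ = x ^ (d + 1) := by field_simp
  · have h := hs.le_tsum d fun n _ => hnn n
    rw [hgd, one_mul] at h
    calc x ^ (d + 2) = x * x ^ (d + 1) := by ring
      _ ≤ (1 - x) * ∑' n, g n * x ^ (n + 1) :=
        mul_le_mul (by linarith) h (pow_pos hx _).le (by linarith)

/-- Let `N` be an almost period of a sequence of integers `F` with bounded differences: the defect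
`F (n + N) - F n - P` takes its values in `{0, s}` for a fixed sign `s`, and it vanishes for
`r ≤ n < L`. The rational number whose base-`b` digits are those of `F`, made periodic of
period `N` from rank `r` on, approximates the number attached to `F` to the order `N + L`, and no
better if the defect is nonzero at `L`. -/
theorem exists_fraction_near {b : ℕ} (hb : 2 ≤ b) {F : ℕ → ℤ} (hF : ∀ n, |F (n + 1) - F n| ≤ 1)
    {N r L : ℕ} {P s : ℤ} (hs : s = 1 ∨ s = -1) (hN : 1 ≤ N) (hrL : r < L)
    (hdef : ∀ n, 0 ≤ s * (F (n + N) - F n - P) ∧ s * (F (n + N) - F n - P) ≤ 1)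
    (hzero : ∀ n, r ≤ n → n < L → F (n + N) - F n - P = 0) {ξ : ℝ}
    (hξ : ξ = ((b : ℝ) - 1) * ∑' n : ℕ, ((F (n + 1) - F n : ℤ) : ℝ) / (b : ℝ) ^ (n + 1)) :
    ∃ (I : ℤ) (Q : ℕ), 0 < Q ∧ Q ≤ b ^ (r + N) ∧ |ξ - I / Q| ≤ b / (b : ℝ) ^ (N + L) ∧
      (F (L + N) - F L - P ≠ 0 → 1 / (b * (b : ℝ) ^ (N + L)) ≤ |ξ - I / Q|) := by
  have hβ : (2 : ℝ) ≤ b := by exact_mod_cast hb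
  have hβ0 : (0 : ℝ) < b := by linarith
  set β : ℝ := (b : ℝ) with hβdef
  set x : ℝ := β⁻¹ with hxdef
  have hx : 0 < x := inv_pos.2 hβ0
  have hx2 : x ≤ 1 / 2 := by
    rw [hxdef, inv_le_comm₀ hβ0 (by norm_num)]; norm_num; exact hβ
  have hxβ : β * x = 1 := mul_inv_cancel₀ hβ0.ne'
  -- the tails of the expansion of `ξ / (b - 1)`, renormalised
  let T : ℕ → ℝ := fun m => ∑' n : ℕ, ((F (n + m + 1) - F (n + m) : ℤ) : ℝ) * x ^ (n + 1)
  have hbd : ∀ m n : ℕ, |((F (n + m + 1) - F (n + m) : ℤ) : ℝ)| ≤ 1 := fun m n => by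
    exact_mod_cast hF (n + m)
  have hTs : ∀ m, Summable fun n : ℕ => ((F (n + m + 1) - F (n + m) : ℤ) : ℝ) * x ^ (n + 1) :=
    fun m => summable_mul_pow_of_bounded hx hx2 (hbd m)
  have hT : ∀ m, β * T m = ((F (m + 1) - F m : ℤ) : ℝ) + T (m + 1) := by
    intro m
    have h := (hTs m).tsum_eq_zero_add
    have h2 : ∑' n : ℕ, ((F (n + 1 + m + 1) - F (n + 1 + m) : ℤ) : ℝ) * x ^ (n + 1 + 1) =
        x * T (m + 1) := by
      rw [← tsum_mul_left]
      refine tsum_congr fun n => ?_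
      rw [show n + 1 + m = n + (m + 1) by ring]; ring
    simp only [T] at h2 ⊢
    rw [h, h2, zero_add, zero_add, pow_one, mul_add]
    linear_combination (((F (m + 1) - F m : ℤ) : ℝ) +
      ∑' n : ℕ, ((F (n + (m + 1) + 1) - F (n + (m + 1)) : ℤ) : ℝ) * x ^ (n + 1)) * hxβ
  have hTint : ∀ m, ∃ z : ℤ, β ^ m * T 0 = z + T m := by
    intro m
    induction m with
    | zero => exact ⟨0, by simp⟩
    | succ m ih =>
      obtain ⟨z, hz⟩ := ih
      refine ⟨b * z + (F (m + 1) - F m), ?_⟩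
      have := hT m
      push_cast at this ⊢
      rw [pow_succ', mul_assoc, hz]; linarith
  have hξT : ξ = (β - 1) * T 0 := by
    rw [hξ]; congr 1
    refine tsum_congr fun n => ?_
    rw [add_zero, hxdef, inv_pow, div_eq_mul_inv]
  -- the defect and its generating series
  let h : ℕ → ℝ := fun n => ((F (n + N) - F n - P : ℤ) : ℝ)
  have hsh : ∀ n, 0 ≤ (s : ℝ) * h n ∧ (s : ℝ) * h n ≤ 1 := fun n => by
    simp only [h]; exact_mod_cast hdef n
  have hsabs : |(s : ℝ)| = 1 := by rcases hs with rfl | rfl <;> simp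
  have hss : (s : ℝ) * s = 1 := by rcases hs with rfl | rfl <;> simp
  have hhabs : ∀ n, |h n| ≤ 1 := fun n => by
    rw [← one_mul |h n|, ← hsabs, ← abs_mul, abs_of_nonneg (hsh n).1, hsabs]; exact (hsh n).2
  let U : ℝ := ∑' n : ℕ, h (n + (r + 1)) * x ^ (n + 1)
  have hsU : Summable fun n : ℕ => h (n + (r + 1)) * x ^ (n + 1) :=
    summable_mul_pow_of_bounded hx hx2 fun n => hhabs _
  have hsV : Summable fun n : ℕ => h (n + r) * x ^ (n + 1) :=
    summable_mul_pow_of_bounded hx hx2 fun n => hhabs _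
  have hhr : h r = 0 := by simp only [h]; exact_mod_cast hzero r le_rfl hrL
  have hV : ∑' n : ℕ, h (n + r) * x ^ (n + 1) = x * U := by
    rw [hsV.tsum_eq_zero_add, zero_add, hhr, zero_mul, zero_add, ← tsum_mul_left]
    refine tsum_congr fun n => ?_
    rw [show n + 1 + r = n + (r + 1) by ring]; ring
  have hdiff : T (r + N) - T r = (1 - x) * U := by
    rw [sub_mul, one_mul, ← hV, ← (hTs _).tsum_sub (hTs _), ← hsU.tsum_sub hsV]
    refine tsum_congr fun n => ?_
    simp only [h]
    rw [show n + (r + 1) + N = n + (r + N) + 1 by ring, show n + (r + 1) = n + r + 1 by ring,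
      show n + r + N = n + (r + N) by ring]
    push_cast; ring
  obtain ⟨z₁, hz₁⟩ := hTint (r + N)
  obtain ⟨z₂, hz₂⟩ := hTint r
  -- `Q = b^r (b^N - 1) / (b - 1)`: the factor `b - 1` cancels against the one in `ξ`
  let Q : ℕ := b ^ r * ∑ i ∈ Finset.range N, b ^ i
  have hQβ : (Q : ℝ) * (β - 1) = β ^ (r + N) - β ^ r := by
    simp only [Q]; push_cast
    rw [mul_assoc, geom_sum_mul, pow_add]; ring
  have hQlow : β ^ (r + N) ≤ β * Q := by
    have hmem : b ^ (N - 1) ≤ ∑ i ∈ Finset.range N, b ^ i :=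
      Finset.single_le_sum (f := fun i => b ^ i) (fun _ _ => Nat.zero_le _)
        (Finset.mem_range.2 (by omega))
    have : b ^ (r + N) ≤ b * Q := by
      calc b ^ (r + N) = b * (b ^ r * b ^ (N - 1)) := by
            rw [← pow_add, ← pow_succ']; congr 1; omega
        _ ≤ b * Q := Nat.mul_le_mul_left _ (Nat.mul_le_mul_left _ hmem)
    rw [hβdef]; exact_mod_cast this
  have hpw : 0 < β ^ (r + N) := pow_pos hβ0 _
  have hQ0R : (0 : ℝ) < Q := by
    by_contra! hc
    nlinarith
  have hQup : (Q : ℝ) ≤ β ^ (r + N) := by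
    have : 1 ≤ β ^ r := one_le_pow₀ (by linarith)
    nlinarith
  have hkey : ξ - ((z₁ - z₂ : ℤ) : ℝ) / Q = (1 - x) * U / Q := by
    have : Q * ξ = (z₁ - z₂ : ℤ) + (1 - x) * U := by
      rw [hξT, ← mul_assoc, hQβ, sub_mul, hz₁, hz₂, ← hdiff]; push_cast; ring
    rw [eq_div_iff hQ0R.ne', sub_mul, div_mul_cancel₀ _ hQ0R.ne']; linarith
  obtain ⟨d, rfl⟩ : ∃ d, L = r + 1 + d := ⟨L - r - 1, by omega⟩
  have hbnd := tsum_mul_pow_bounds hx hx2 (g := fun n => s * h (n + (r + 1))) d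
    (fun n => (hsh _).1) (fun n => (hsh _).2) (fun n hn => by
      have : h (n + (r + 1)) = 0 := by
        simp only [h]; exact_mod_cast hzero _ (by omega) (by omega)
      simp [this])
  have hsU2 : ∑' n : ℕ, (s : ℝ) * h (n + (r + 1)) * x ^ (n + 1) = s * U := by
    rw [← tsum_mul_left]; exact tsum_congr fun n => mul_assoc _ _ _
  rw [hsU2] at hbnd
  have habs : |(1 - x) * U| = (1 - x) * (s * U) := by
    rw [← abs_of_nonneg hbnd.1, abs_mul, abs_mul, abs_mul, hsabs, one_mul]
  have hNL : β ^ (N + (r + 1 + d)) = β ^ (r + N) * β ^ (d + 1) := by rw [← pow_add]; congr 1; ring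
  have hxp : ∀ m, x ^ m * β ^ m = 1 := fun m => by
    rw [← mul_pow, mul_comm x, hxβ, one_pow]
  refine ⟨z₁ - z₂, Q, by exact_mod_cast hQ0R, by rw [hβdef] at hQup; exact_mod_cast hQup, ?_,
    fun hne => ?_⟩
  · rw [hkey, abs_div, habs, abs_of_pos hQ0R, hNL, div_le_div_iff₀ hQ0R (by positivity)]
    calc _ ≤ x ^ (d + 1) * (β ^ (r + N) * β ^ (d + 1)) := by gcongr; exact hbnd.2.1
      _ = x ^ (d + 1) * β ^ (d + 1) * β ^ (r + N) := by ring
      _ ≤ β * Q := by rw [hxp, one_mul]; exact hQlow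
  · have hgd : (s : ℝ) * h (d + (r + 1)) = 1 := by
      have h1 := hdef (r + 1 + d)
      have hne' : s * (F (r + 1 + d + N) - F (r + 1 + d) - P) ≠ 0 :=
        mul_ne_zero (by rcases hs with rfl | rfl <;> simp) hne
      have : s * (F (r + 1 + d + N) - F (r + 1 + d) - P) = 1 := by omega
      simp only [h]
      rw [show d + (r + 1) = r + 1 + d by ring]
      exact_mod_cast this
    have h3 := hbnd.2.2 hgd
    rw [hkey, abs_div, habs, abs_of_pos hQ0R, hNL, div_le_div_iff₀ (by positivity) hQ0R, one_mul]
    calc (Q : ℝ) ≤ β ^ (r + N) := hQup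
      _ = x ^ (d + 2) * β ^ (d + 2) * β ^ (r + N) := by rw [hxp, one_mul]
      _ = x ^ (d + 2) * (β * (β ^ (r + N) * β ^ (d + 1))) := by ring
      _ ≤ _ := by gcongr

end Sturmian

namespace Sturmian

/-! ### Roundings and sides -/

/-- A rounding `Φ` of real numbers to integers, with the half-line `{x | pos x}` on which it is
nonnegative. The two instances are `⌊·⌋` with `0 ≤ x`, for lower Sturmian words, and `⌈·⌉ - 1` with
`0 < x`, for upper ones. -/
structure IsRounding (pos : ℝ → Prop) (Φ : ℝ → ℤ) : Prop where
  le_iff : ∀ (x : ℝ) (n : ℤ), n ≤ Φ x ↔ pos (x - n)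
  mono : ∀ x y : ℝ, x ≤ y → pos x → pos y
  of_pos : ∀ x : ℝ, 0 < x → pos x
  nonneg : ∀ x : ℝ, pos x → 0 ≤ x

theorem isRounding_floor : IsRounding (fun x => 0 ≤ x) (fun x => ⌊x⌋) where
  le_iff x n := by rw [Int.le_floor, sub_nonneg]
  mono _ _ h h' := h'.trans h
  of_pos _ h := h.le
  nonneg _ h := h

theorem isRounding_ceil : IsRounding (fun x => 0 < x) (fun x => ⌈x⌉ - 1) where
  le_iff x n := by rw [Int.le_sub_one_iff, Int.lt_ceil, sub_pos]
  mono _ _ h h' := h'.trans_le h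
  of_pos _ h := h
  nonneg _ h := h.le

/-- `z` has the sign of `(-1)^k`, where the sign of `0` is the one that `pos` prescribes. -/
def Side (pos : ℝ → Prop) (k : ℕ) (z : ℝ) : Prop := (Even k ∧ pos z) ∨ (Odd k ∧ ¬ pos z)

variable {pos : ℝ → Prop} {Φ : ℝ → ℤ}

theorem side_even {k : ℕ} (hk : Even k) (z : ℝ) : Side pos k z ↔ pos z := by
  simp [Side, hk, Nat.not_odd_iff_even.2 hk]

theorem side_odd {k : ℕ} (hk : Odd k) (z : ℝ) : Side pos k z ↔ ¬ pos z := by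
  simp [Side, hk, Nat.not_even_iff_odd.2 hk]

theorem side_add_two (k : ℕ) (z : ℝ) : Side pos (k + 2) z ↔ Side pos k z := by
  rcases Nat.even_or_odd k with h | h
  · rw [side_even h, side_even (h.add even_two)]
  · rw [side_odd h, side_odd (h.add_even even_two)]

theorem IsRounding.side_add (hc : IsRounding pos Φ) {k : ℕ} {z w : ℝ} (hz : Side pos k z)
    (hw : 0 ≤ (-1) ^ k * w) : Side pos k (z + w) := by
  rcases Nat.even_or_odd k with h | h
  · rw [side_even h] at *
    rw [h.neg_one_pow] at hw
    exact hc.mono _ _ (by linarith) hz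
  · rw [side_odd h] at *
    rw [h.neg_one_pow] at hw
    exact fun hp => hz (hc.mono _ _ (by linarith) hp)

theorem IsRounding.side_of_pos (hc : IsRounding pos Φ) {k : ℕ} {z : ℝ}
    (hz : 0 < (-1) ^ k * z) : Side pos k z := by
  rcases Nat.even_or_odd k with h | h
  · rw [side_even h]
    rw [h.neg_one_pow] at hz
    exact hc.of_pos _ (by linarith)
  · rw [side_odd h]
    rw [h.neg_one_pow] at hz
    exact fun hp => by linarith [hc.nonneg _ hp]

theorem IsRounding.lt_of_side (hc : IsRounding pos Φ) {k : ℕ} {x y : ℝ} (hx : Side pos k x)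
    (hy : Side pos (k + 1) y) : (-1) ^ k * y < (-1) ^ k * x := by
  have key : ∀ x y : ℝ, pos x → ¬ pos y → y < x := fun x y hx hy => by
    by_contra! hc'
    exact hy (hc.mono _ _ hc' hx)
  rcases Nat.even_or_odd k with h | h
  · rw [side_even h] at hx
    rw [side_odd h.add_one] at hy
    rw [h.neg_one_pow]
    linarith [key x y hx hy]
  · rw [side_odd h] at hx
    rw [side_even h.add_one] at hy
    rw [h.neg_one_pow]
    linarith [key y x hy hx]

theorem IsRounding.monotone (hc : IsRounding pos Φ) : Monotone Φ := fun x y hxy =>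
  (hc.le_iff y _).2 (hc.mono _ _ (by linarith) ((hc.le_iff x _).1 le_rfl))

theorem IsRounding.add_int (hc : IsRounding pos Φ) (x : ℝ) (n : ℤ) : Φ (x + n) = Φ x + n := by
  have key : ∀ m, m ≤ Φ (x + n) ↔ m ≤ Φ x + n := fun m => by
    rw [hc.le_iff, ← sub_le_iff_le_add, hc.le_iff]
    push_cast
    rw [show x + (n : ℝ) - m = x - (m - n) by ring]
  exact le_antisymm ((key _).1 le_rfl) ((key _).2 le_rfl)

/-- Adding a small number of sign `(-1)^k` changes the rounding by `0` or `(-1)^k`. -/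
theorem IsRounding.defect_bounds (hc : IsRounding pos Φ) {k : ℕ} {δ : ℝ} (h0 : 0 ≤ (-1) ^ k * δ)
    (h1 : (-1) ^ k * δ ≤ 1) (x : ℝ) :
    0 ≤ (-1) ^ k * (Φ (x + δ) - Φ x) ∧ (-1) ^ k * (Φ (x + δ) - Φ x) ≤ 1 := by
  rcases Nat.even_or_odd k with h | h
  · rw [h.neg_one_pow] at *
    have a := hc.monotone (show x ≤ x + δ by linarith)
    have b := hc.monotone (show x + δ ≤ x + (1 : ℤ) by push_cast; linarith)
    rw [hc.add_int] at b
    constructor <;> linarith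
  · rw [h.neg_one_pow] at *
    have a := hc.monotone (show x + δ ≤ x by linarith)
    have b := hc.monotone (show x + (-1 : ℤ) ≤ x + δ by push_cast; linarith)
    rw [hc.add_int] at b
    constructor <;> linarith

/-- The rounding changes when a number of sign `(-1)^k` is added if and only if an integer is
crossed. -/
theorem IsRounding.ne_iff (hc : IsRounding pos Φ) {k : ℕ} {δ : ℝ} (h0 : 0 ≤ (-1) ^ k * δ)
    (x : ℝ) : Φ (x + δ) - Φ x ≠ 0 ↔
      ∃ g : ℤ, Side pos (k + 1) (x - g) ∧ Side pos k (x - g + δ) := by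
  have key : ∀ g : ℤ, x - g + δ = x + δ - g := fun g => by ring
  rcases Nat.even_or_odd k with h | h
  · simp only [side_odd h.add_one, side_even h, key, ← hc.le_iff]
    rw [h.neg_one_pow] at h0
    have a := hc.monotone (show x ≤ x + δ by linarith)
    exact ⟨fun hne => ⟨Φ x + 1, by omega, by omega⟩, fun ⟨g, h1, h2⟩ => by omega⟩
  · simp only [side_even h.add_one, side_odd h, key, ← hc.le_iff]
    rw [h.neg_one_pow] at h0
    have a := hc.monotone (show x + δ ≤ x by linarith)
    exact ⟨fun hne => ⟨Φ x, by omega, by omega⟩, fun ⟨g, h1, h2⟩ => by omega⟩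

/-! ### Approximations of prescribed quality -/

/-- `ξ` has a rational approximation of denominator at most `b^D`, with an error of order at most
`b^(-D-E)`. -/
def IsApprox (b : ℕ) (ξ : ℝ) (D E : ℕ) : Prop :=
  ∃ (I : ℤ) (Q : ℕ), 0 < Q ∧ Q ≤ b ^ D ∧ |ξ - I / Q| ≤ (b : ℝ) ^ 2 / (b : ℝ) ^ (D + E)

/-- `ξ` has a rational approximation of denominator at most `b^D`, with an error of the exact order
`b^(-D-E)`. -/
def IsSharpApprox (b : ℕ) (ξ : ℝ) (D E : ℕ) : Prop :=
  ∃ (I : ℤ) (Q : ℕ), 0 < Q ∧ Q ≤ b ^ D ∧ |ξ - I / Q| ≤ (b : ℝ) ^ 2 / (b : ℝ) ^ (D + E) ∧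
    1 / (b : ℝ) ^ (D + E) ≤ |ξ - I / Q|

theorem IsSharpApprox.isApprox {b : ℕ} {ξ : ℝ} {D E : ℕ} (h : IsSharpApprox b ξ D E) :
    IsApprox b ξ D E :=
  let ⟨I, Q, h0, h1, h2, _⟩ := h
  ⟨I, Q, h0, h1, h2⟩

theorem IsApprox.mono {b : ℕ} (hb : 2 ≤ b) {ξ : ℝ} {D E E' : ℕ} (h : IsApprox b ξ D E)
    (hE : E' ≤ E) : IsApprox b ξ D E' := by
  obtain ⟨I, Q, h0, h1, h2⟩ := h
  refine ⟨I, Q, h0, h1, h2.trans ?_⟩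
  have : (1 : ℝ) ≤ b := by exact_mod_cast (by omega : 1 ≤ b)
  gcongr

/-- The number `(b - 1) ∑ (F_n - F_{n-1}) / b^n`, where `F_n = Φ ((n + 1) θ + σ)`. -/
noncomputable def roundingNumber (b : ℕ) (Φ : ℝ → ℤ) (θ σ : ℝ) : ℝ :=
  ((b : ℝ) - 1) * ∑' n : ℕ,
    ((Φ (((n + 2 : ℕ) : ℝ) * θ + σ) - Φ (((n + 1 : ℕ) : ℝ) * θ + σ) : ℤ) : ℝ) / (b : ℝ) ^ (n + 1)

/-- An approximation of the number attached to the orbit of `σ` from an almost period `N` of the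
orbit, in terms of the times `u` at which the translation by `Nθ - P` makes the orbit cross an
integer. -/
theorem IsRounding.exists_fraction (hc : IsRounding pos Φ) {b : ℕ} (hb : 2 ≤ b) {θ σ : ℝ}
    (h0 : 0 ≤ θ) (h1 : θ < 1) {N r L k : ℕ} {P : ℤ} (hN : 1 ≤ N) (hrL : r + 1 < L)
    (hδ0 : 0 ≤ (-1) ^ k * (N * θ - P)) (hδ1 : (-1) ^ k * (N * θ - P) ≤ 1)
    (hzero : ∀ u : ℕ, r < u → u < L → Φ (u * θ + σ + (N * θ - P)) - Φ (u * θ + σ) = 0) :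
    ∃ (I : ℤ) (Q : ℕ), 0 < Q ∧ Q ≤ b ^ (r + N) ∧
      |roundingNumber b Φ θ σ - I / Q| ≤ (b : ℝ) ^ 2 / (b : ℝ) ^ (N + L) ∧
      (Φ (L * θ + σ + (N * θ - P)) - Φ (L * θ + σ) ≠ 0 →
        1 / (b : ℝ) ^ (N + L) ≤ |roundingNumber b Φ θ σ - I / Q|) := by
  have hb0 : (b : ℝ) ≠ 0 := by positivity
  have hdef : ∀ u : ℕ, Φ (((u + N + 1 : ℕ) : ℝ) * θ + σ) - Φ (((u + 1 : ℕ) : ℝ) * θ + σ) - P =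
      Φ (((u + 1 : ℕ) : ℝ) * θ + σ + (N * θ - P)) - Φ (((u + 1 : ℕ) : ℝ) * θ + σ) := by
    intro u
    have := hc.add_int (((u + 1 : ℕ) : ℝ) * θ + σ + (N * θ - P)) P
    rw [show ((u + 1 : ℕ) : ℝ) * θ + σ + (N * θ - P) + P = ((u + N + 1 : ℕ) : ℝ) * θ + σ by
      push_cast; ring] at this
    omega
  obtain ⟨L, rfl⟩ : ∃ M, L = M + 1 := ⟨L - 1, by omega⟩
  have hF : ∀ n : ℕ, |Φ (((n + 1 + 1 : ℕ) : ℝ) * θ + σ) - Φ (((n + 1 : ℕ) : ℝ) * θ + σ)| ≤ 1 := by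
    intro n
    have := hc.defect_bounds (k := 0) (δ := θ) (by simpa using h0) (by simpa using h1.le)
      (((n + 1 : ℕ) : ℝ) * θ + σ)
    rw [show ((n + 1 : ℕ) : ℝ) * θ + σ + θ = ((n + 1 + 1 : ℕ) : ℝ) * θ + σ by push_cast; ring]
      at this
    rw [abs_le]
    simp only [pow_zero, one_mul] at this
    constructor <;> linarith
  obtain ⟨I, Q, hQ0, hQ, hup, hlow⟩ := exists_fraction_near (ξ := roundingNumber b Φ θ σ) hb
    (F := fun n => Φ (((n + 1 : ℕ) : ℝ) * θ + σ)) hF (neg_one_pow_eq_or ℤ k) hN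
    (show r < L by omega) (fun n => by rw [hdef]; exact hc.defect_bounds hδ0 hδ1 _)
    (fun n hn hn' => by rw [hdef]; exact hzero (n + 1) (by omega) (by omega)) rfl
  refine ⟨I, Q, hQ0, hQ, ?_, fun h => ?_⟩
  · rw [show N + (L + 1) = N + L + 1 by ring, pow_succ _ (N + L), pow_two,
      mul_div_mul_right _ _ hb0]
    exact hup
  · rw [show N + (L + 1) = N + L + 1 by ring, pow_succ, mul_comm]
    exact hlow (by rw [hdef]; exact h)

end Sturmian

namespace Sturmian

/-! ### Codings -/

/-- `r_k = q_k - t_k` as a natural number. -/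
noncomputable def rn (θ : ℝ) (d : ℕ → ℕ) (k : ℕ) : ℕ := qd θ k - tk θ d k

/-- The digits `d` code the orbit of `σ` under the rotation by `θ`: from some rank `K` on they obey
the Ostrowski rules, and the point `r_k θ + σ` lies, modulo the integer `s k`, on the side `(-1)^k`
of `0`. -/
structure IsCoding (pos : ℝ → Prop) (θ σ : ℝ) (d : ℕ → ℕ) (s : ℕ → ℤ) (K : ℕ) : Prop where
  irrational : Irrational θ
  slope_nonneg : 0 ≤ θ
  slope_lt_one : θ < 1
  le : ∀ k, K ≤ k → d (k + 1) ≤ pq θ (k + 1)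
  zero : ∀ k, K ≤ k → d (k + 2) = pq θ (k + 2) → d (k + 1) = 0
  tk_lt : ∀ k, K ≤ k → tk θ d k < qd θ k
  s_succ : ∀ k, s (k + 1) = s k + pn θ (k + 1) - (1 + d (k + 1)) * pn θ k
  side : ∀ k, K ≤ k → Side pos k (((rk θ d k : ℤ) : ℝ) * θ + σ - s k)

theorem tk_succ (θ : ℝ) (d : ℕ → ℕ) (k : ℕ) :
    tk θ d (k + 1) = tk θ d k + d (k + 1) * qd θ k := by
  rw [tk, Finset.sum_range_succ, tk]

/-- The position `y_k` of the orbit of `σ` at the time `r_k`, relative to the integer `s k`. -/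
noncomputable def point (θ σ : ℝ) (d : ℕ → ℕ) (s : ℕ → ℤ) (k : ℕ) : ℝ :=
  (rn θ d k : ℝ) * θ + σ - s k

namespace IsCoding

variable {pos : ℝ → Prop} {Φ : ℝ → ℤ} {θ σ : ℝ} {d : ℕ → ℕ} {s : ℕ → ℤ} {K : ℕ}

theorem rk_eq (h : IsCoding pos θ σ d s K) {k : ℕ} (hk : K ≤ k) : rk θ d k = rn θ d k := by
  have := h.tk_lt k hk
  rw [rk, rn]; omega

theorem rn_add_tk (h : IsCoding pos θ σ d s K) {k : ℕ} (hk : K ≤ k) :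
    rn θ d k + tk θ d k = qd θ k := by
  have := h.tk_lt k hk
  rw [rn]; omega

theorem rn_pos (h : IsCoding pos θ σ d s K) {k : ℕ} (hk : K ≤ k) : 1 ≤ rn θ d k := by
  have := h.tk_lt k hk
  rw [rn]; omega

/-- The length `r_{k+2}` in terms of the multiplicity `a_{k+2} - d_{k+2}`. -/
theorem rn_add_two (h : IsCoding pos θ σ d s K) {k : ℕ} (hk : K ≤ k) :
    rn θ d (k + 2) + tk θ d (k + 1) =
      (pq θ (k + 2) - d (k + 2)) * qd θ (k + 1) + qd θ k := by
  have h1 := h.rn_add_tk (k := k + 2) (by omega)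
  have h2 := h.le (k + 1) (by omega)
  have h3 := tk_succ θ d (k + 1)
  obtain ⟨e, he⟩ := Nat.exists_eq_add_of_le h2
  simp only [add_assoc, Nat.reduceAdd] at *
  rw [qd, he] at h1
  rw [he, Nat.add_sub_cancel_left]
  nlinarith

theorem point_succ (h : IsCoding pos θ σ d s K) (k : ℕ) :
    ((rk θ d (k + 1) : ℤ) : ℝ) * θ + σ - s (k + 1) =
      ((rk θ d k : ℤ) : ℝ) * θ + σ - s k + thetaSeq θ (k + 1) -
        (1 + d (k + 1)) * thetaSeq θ k := by
  rw [h.s_succ]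
  simp only [rk, tk_succ, thetaSeq]
  push_cast; ring

theorem side_point (h : IsCoding pos θ σ d s K) {k : ℕ} (hk : K ≤ k) :
    Side pos k (point θ σ d s k) := by
  have := h.side k hk
  rw [h.rk_eq hk] at this
  exact_mod_cast this

/-- The recursion `y_{k+1} = y_k + θ_{k+1} - (1 + d_{k+1}) θ_k`. -/
theorem point_succ_eq (h : IsCoding pos θ σ d s K) {k : ℕ} (hk : K ≤ k) :
    point θ σ d s (k + 1) =
      point θ σ d s k + thetaSeq θ (k + 1) - (1 + d (k + 1)) * thetaSeq θ k := by
  have := h.point_succ k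
  rw [h.rk_eq hk, h.rk_eq (by omega)] at this
  simpa [point] using this

theorem sign_mul_theta (θ : ℝ) (k : ℕ) : (-1) ^ k * thetaSeq θ k = tau θ k := rfl

theorem sign_mul_theta_succ (θ : ℝ) (k : ℕ) : (-1) ^ k * thetaSeq θ (k + 1) = -tau θ (k + 1) := by
  rw [tau, pow_succ]; ring

theorem sign_mul_theta_add_two (θ : ℝ) (k : ℕ) :
    (-1) ^ k * thetaSeq θ (k + 2) = tau θ (k + 2) := by
  rw [tau, pow_add]; norm_num

theorem tau_pos (h : IsCoding pos θ σ d s K) (k : ℕ) : 0 < tau θ k :=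
  Sturmian.tau_pos h.irrational h.slope_nonneg h.slope_lt_one k

/-- If the digit `d_{k+2}` is not maximal, then the translation by `θ_k` takes the point `y_{k+1}`
across `0`. -/
theorem side_point_add (h : IsCoding pos θ σ d s K) (hc : IsRounding pos Φ) {k : ℕ} (hk : K ≤ k)
    (hd : d (k + 2) < pq θ (k + 2)) : Side pos k (point θ σ d s (k + 1) + thetaSeq θ k) := by
  have e := h.point_succ_eq (k := k + 1) (by omega)
  have hs := (side_add_two _ _).1 (h.side_point (k := k + 2) (by omega))
  have hr := thetaSeq_rec θ k
  simp only [add_assoc, Nat.reduceAdd] at e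
  rw [show point θ σ d s (k + 1) + thetaSeq θ k = point θ σ d s (k + 2) +
    (pq θ (k + 2) - 1 - d (k + 2)) * -thetaSeq θ (k + 1) by rw [e, hr]; ring]
  refine hc.side_add hs ?_
  have h1 : (0 : ℝ) ≤ pq θ (k + 2) - 1 - d (k + 2) := by
    have : (d (k + 2) : ℝ) + 1 ≤ pq θ (k + 2) := by exact_mod_cast hd
    linarith
  have h2 := sign_mul_theta_succ θ k
  calc (0 : ℝ) ≤ (pq θ (k + 2) - 1 - d (k + 2)) * tau θ (k + 1) := mul_nonneg h1 (h.tau_pos _).le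
    _ = _ := by linear_combination (pq θ (k + 2) - 1 - d (k + 2) : ℝ) * h2

/-! ### Crossing times -/

/-- Two crossing times of the convergent `q_{k+1}` are at least `q_{k+2}` apart. -/
theorem no_crossing_convergent (h : IsCoding pos θ σ d s K) (hc : IsRounding pos Φ) {k u v : ℕ}
    {g : ℤ} (hv : Side pos k (v * θ + σ - g))
    (hv' : Side pos (k + 1) (v * θ + σ - g + thetaSeq θ (k + 1))) (huv : u ≠ v)
    (h1 : u < v + qd θ (k + 2)) (h2 : v < u + qd θ (k + 2)) :
    Φ (u * θ + σ + thetaSeq θ (k + 1)) - Φ (u * θ + σ) = 0 := by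
  by_contra hne
  have hsg : 0 ≤ (-1) ^ (k + 1) * thetaSeq θ (k + 1) := (h.tau_pos (k + 1)).le
  obtain ⟨g', hu, hu'⟩ := (hc.ne_iff hsg _).1 hne
  rw [show k + 1 + 1 = k + 2 by ring, side_add_two] at hu
  have a1 := hc.lt_of_side hu hv'
  have a2 := hc.lt_of_side hv hu'
  have hp := pow_succ (-1 : ℝ) k
  have ht := sign_mul_theta_succ θ k
  have htr := tau_rec θ k
  have hq : qd θ (k + 2) = pq θ (k + 2) * qd θ (k + 1) + qd θ k := rfl
  have hpq := pq_pos h.irrational h.slope_nonneg h.slope_lt_one (k + 1)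
  have htp := h.tau_pos (k + 2)
  obtain ⟨e, he⟩ : ∃ e, pq θ (k + 2) = e + 1 := ⟨pq θ (k + 2) - 1, by
    simp only [add_assoc, Nat.reduceAdd] at *; omega⟩
  rw [he] at htr hq
  have hqZ : (qd θ (k + 2) : ℤ) = (e + 1) * qd θ (k + 1) + qd θ k := by rw [hq]; push_cast; ring
  push_cast at htr
  rcases lt_or_gt_of_ne huv with hlt | hlt
  · refine not_mem_gap h.irrational h.slope_nonneg h.slope_lt_one k e ((v : ℤ) - u) (g - g')
      (by omega) (by omega) ?_ ?_
    · rw [hp]; push_cast; linarith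
    · rw [hp]; push_cast; linarith
  · refine not_mem_gap h.irrational h.slope_nonneg h.slope_lt_one k e ((u : ℤ) - v) (g' - g)
      (by omega) (by omega) ?_ ?_
    · rw [hp]; push_cast; linarith
    · rw [hp]; push_cast; linarith

/-- Before a crossing time `L` at which the orbit is within `θ_{k+1}` of `0`, there is no crossing
time of the semiconvergent `e q_{k+1} + q_k` during `(e + 1) q_{k+1} + q_k` steps. -/
theorem no_crossing_semiconvergent (h : IsCoding pos θ σ d s K) (hc : IsRounding pos Φ)
    {k e u L : ℕ} (he : e ≤ pq θ (k + 2)) {g : ℤ} (hL : Side pos (k + 1) (L * θ + σ - g))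
    (hL' : Side pos k (L * θ + σ - g - thetaSeq θ (k + 1))) (huL : u < L)
    (hLu : L < u + ((e + 1) * qd θ (k + 1) + qd θ k)) :
    Φ (u * θ + σ + (e * thetaSeq θ (k + 1) + thetaSeq θ k)) - Φ (u * θ + σ) = 0 := by
  by_contra hne
  have ht := sign_mul_theta_succ θ k
  have ht0 := sign_mul_theta θ k
  have htr := tau_rec θ k
  have hsg : 0 ≤ (-1) ^ k * (e * thetaSeq θ (k + 1) + thetaSeq θ k) := by
    have h1 : (-1) ^ k * (e * thetaSeq θ (k + 1) + thetaSeq θ k) =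
        tau θ k - e * tau θ (k + 1) := by linear_combination (e : ℝ) * ht + ht0
    have h2 : (e : ℝ) ≤ pq θ (k + 2) := by exact_mod_cast he
    have := mul_le_mul_of_nonneg_right h2 (h.tau_pos (k + 1)).le
    have := h.tau_pos (k + 2)
    rw [h1]; linarith
  obtain ⟨g', hu, hu'⟩ := (hc.ne_iff hsg _).1 hne
  have a1 := hc.lt_of_side hL' hu
  have a2 := hc.lt_of_side hu' hL
  have hp := pow_succ (-1 : ℝ) k
  have ht' : (-1) ^ k * (e * thetaSeq θ (k + 1)) = - (e * tau θ (k + 1)) := by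
    linear_combination (e : ℝ) * ht
  have hLu' : (L : ℤ) < u + ((e + 1) * qd θ (k + 1) + qd θ k) := by exact_mod_cast hLu
  refine not_mem_gap h.irrational h.slope_nonneg h.slope_lt_one k e ((L : ℤ) - u) (g - g')
    (by omega) (by linarith) ?_ ?_
  · rw [hp]; push_cast; linarith
  · rw [hp]; push_cast; linarith

end IsCoding

end Sturmian

namespace Sturmian

namespace IsCoding

variable {pos : ℝ → Prop} {Φ : ℝ → ℤ} {θ σ : ℝ} {d : ℕ → ℕ} {s : ℕ → ℤ} {K : ℕ}

/-! ### The four families of approximations -/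

theorem qd_pos (h : IsCoding pos θ σ d s K) (k : ℕ) : 1 ≤ qd θ k :=
  Sturmian.qd_pos h.irrational h.slope_nonneg h.slope_lt_one k

theorem tau_lt_one (h : IsCoding pos θ σ d s K) (k : ℕ) : tau θ k < 1 :=
  Sturmian.tau_lt_one h.irrational h.slope_nonneg h.slope_lt_one k

/-- The purely periodic approximation of period `q_{k+1}`, whose first crossing time is `r_{k+2}`.
If `r_{k+2} = 1`, then the crossing comes before the start of the word. -/
theorem sharp_convergent (h : IsCoding pos θ σ d s K) (hc : IsRounding pos Φ) {b : ℕ} (hb : 2 ≤ b)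
    {k : ℕ} (hk : K ≤ k) (hd : d (k + 3) < pq θ (k + 3)) (hr : 2 ≤ rn θ d (k + 2)) :
    IsSharpApprox b (roundingNumber b Φ θ σ) (qd θ (k + 1)) (rn θ d (k + 2)) := by
  have hv := (side_add_two _ _).1 (h.side_point (k := k + 2) (by omega))
  have hv' := h.side_point_add hc (k := k + 1) (by omega) hd
  have hsg : 0 ≤ (-1) ^ (k + 1) * thetaSeq θ (k + 1) := (h.tau_pos (k + 1)).le
  have hsum := h.rn_add_tk (k := k + 2) (by omega)
  obtain ⟨I, Q, h1, h2, h3, h4⟩ := hc.exists_fraction hb (σ := σ) h.slope_nonneg h.slope_lt_one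
    (N := qd θ (k + 1)) (r := 0) (L := rn θ d (k + 2)) (k := k + 1) (P := pn θ (k + 1))
    (h.qd_pos _) (by omega) hsg (h.tau_lt_one _).le (fun u hu hu' =>
      h.no_crossing_convergent hc hv hv' (by omega) (by omega) (by omega))
  rw [zero_add] at h2
  exact ⟨I, Q, h1, h2, h3, h4 ((hc.ne_iff hsg _).2
    ⟨s (k + 2), (side_add_two _ _).2 hv, hv'⟩)⟩

theorem semiconvergent_sign (h : IsCoding pos θ σ d s K) {k e : ℕ} (he : e ≤ pq θ (k + 2)) :
    0 ≤ (-1) ^ k * (e * thetaSeq θ (k + 1) + thetaSeq θ k) ∧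
    (-1) ^ k * (e * thetaSeq θ (k + 1) + thetaSeq θ k) ≤ 1 := by
  have h1 : (-1) ^ k * (e * thetaSeq θ (k + 1) + thetaSeq θ k) =
      tau θ k - e * tau θ (k + 1) := by
    linear_combination (e : ℝ) * sign_mul_theta_succ θ k + sign_mul_theta θ k
  have h2 : (e : ℝ) ≤ pq θ (k + 2) := by exact_mod_cast he
  have h3 := mul_le_mul_of_nonneg_right h2 (h.tau_pos (k + 1)).le
  have h4 : (0 : ℝ) ≤ e * tau θ (k + 1) := mul_nonneg (Nat.cast_nonneg e) (h.tau_pos (k + 1)).le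
  have := h.tau_pos (k + 2)
  have := h.tau_lt_one k
  have := tau_rec θ k
  rw [h1]
  constructor <;> linarith

theorem theta_semiconvergent (θ : ℝ) (k e : ℕ) :
    ((e * qd θ (k + 1) + qd θ k : ℕ) : ℝ) * θ - ((e * pn θ (k + 1) + pn θ k : ℕ) : ℤ) =
      e * thetaSeq θ (k + 1) + thetaSeq θ k := by
  simp only [thetaSeq]; push_cast; ring

/-- The approximation given by a semiconvergent of period `e q_{k+1} + q_k`, from a rank `r` up to
the crossing time `r_{k+2} + q_{k+1}`. The condition on `e` makes this a crossing time. -/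
theorem sharp_semiconvergent (h : IsCoding pos θ σ d s K) (hc : IsRounding pos Φ) {b : ℕ}
    (hb : 2 ≤ b) {k e r : ℕ} (hk : K ≤ k) (he : e + 1 ≤ pq θ (k + 2))
    (hd : d (k + 3) < pq θ (k + 3))
    (hr : rn θ d (k + 2) + qd θ (k + 1) ≤ r + ((e + 1) * qd θ (k + 1) + qd θ k))
    (hr' : r + 1 < rn θ d (k + 2) + qd θ (k + 1)) :
    ∃ (I : ℤ) (Q : ℕ), 0 < Q ∧ Q ≤ b ^ (r + (e * qd θ (k + 1) + qd θ k)) ∧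
      |roundingNumber b Φ θ σ - I / Q| ≤
        (b : ℝ) ^ 2 / (b : ℝ) ^ (e * qd θ (k + 1) + qd θ k + (rn θ d (k + 2) + qd θ (k + 1))) ∧
      1 / (b : ℝ) ^ (e * qd θ (k + 1) + qd θ k + (rn θ d (k + 2) + qd θ (k + 1))) ≤
        |roundingNumber b Φ θ σ - I / Q| := by
  have hepq : e ≤ pq θ (k + 2) := by omega
  obtain ⟨hs0, hs1⟩ := h.semiconvergent_sign hepq
  have hL := h.side_point_add hc (k := k + 1) (by omega) hd
  have hL' := h.side_point (k := k + 2) (by omega)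
  have hpt : ((rn θ d (k + 2) + qd θ (k + 1) : ℕ) : ℝ) * θ + σ -
      ((s (k + 2) + pn θ (k + 1) : ℤ) : ℝ) = point θ σ d s (k + 2) + thetaSeq θ (k + 1) := by
    simp only [point, thetaSeq]; push_cast; ring
  have hth := theta_semiconvergent θ k e
  have hcross : Side pos k (point θ σ d s (k + 2) + thetaSeq θ (k + 1) +
      (e * thetaSeq θ (k + 1) + thetaSeq θ k)) := by
    have hrec := thetaSeq_rec θ k
    rw [show point θ σ d s (k + 2) + thetaSeq θ (k + 1) + (e * thetaSeq θ (k + 1) + thetaSeq θ k)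
      = point θ σ d s (k + 2) +
        (thetaSeq θ (k + 2) + (pq θ (k + 2) - e - 1) * -thetaSeq θ (k + 1)) by rw [hrec]; ring]
    refine hc.side_add ((side_add_two _ _).1 hL') ?_
    have h1 : (0 : ℝ) ≤ pq θ (k + 2) - e - 1 := by
      have : (e : ℝ) + 1 ≤ pq θ (k + 2) := by exact_mod_cast he
      linarith
    have e1 := sign_mul_theta_succ θ k
    have e2 := sign_mul_theta_add_two θ k
    have e3 := mul_nonneg h1 (h.tau_pos (k + 1)).le
    have e4 := h.tau_pos (k + 2)
    have e5 : (-1) ^ k * (thetaSeq θ (k + 2) + (pq θ (k + 2) - e - 1) * -thetaSeq θ (k + 1)) =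
        tau θ (k + 2) + (pq θ (k + 2) - e - 1) * tau θ (k + 1) := by
      linear_combination e2 - (pq θ (k + 2) - e - 1 : ℝ) * e1
    rw [e5]; linarith
  obtain ⟨I, Q, h1, h2, h3, h4⟩ := hc.exists_fraction hb (σ := σ) h.slope_nonneg h.slope_lt_one
    (N := e * qd θ (k + 1) + qd θ k) (r := r) (L := rn θ d (k + 2) + qd θ (k + 1)) (k := k)
    (P := ((e * pn θ (k + 1) + pn θ k : ℕ) : ℤ)) (by have := h.qd_pos k; omega) hr'
    (by rw [hth]; exact hs0) (by rw [hth]; exact hs1) (fun u hu hu' => by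
      rw [hth]
      refine h.no_crossing_semiconvergent hc hepq (g := s (k + 2) + pn θ (k + 1))
        (by rw [hpt]; exact hL)
        (by rw [hpt, add_sub_cancel_right]; exact (side_add_two _ _).1 hL') hu' (by omega))
  refine ⟨I, Q, h1, h2, h3, h4 ?_⟩
  rw [hth, hc.ne_iff hs0]
  exact ⟨s (k + 2) + pn θ (k + 1), by rw [hpt]; exact hL, by rw [hpt]; exact hcross⟩

/-- The approximation of preperiod `r_{k+1}` and period `r_{k+2} - r_{k+1}`, which is
`e q_{k+1} + q_k` with `e = a_{k+2} - d_{k+2} - 1`. -/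
theorem sharp_short (h : IsCoding pos θ σ d s K) (hc : IsRounding pos Φ) {b : ℕ}
    (hb : 2 ≤ b) {k : ℕ} (hk : K ≤ k) (hd' : d (k + 2) < pq θ (k + 2))
    (hd : d (k + 3) < pq θ (k + 3)) :
    IsSharpApprox b (roundingNumber b Φ θ σ) (rn θ d (k + 2))
      (rn θ d (k + 2) + tk θ d (k + 1)) := by
  obtain ⟨e, he⟩ : ∃ e, pq θ (k + 2) = e + 1 + d (k + 2) :=
    ⟨pq θ (k + 2) - d (k + 2) - 1, by omega⟩
  have e1 := h.rn_add_two hk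
  have e2 := h.rn_add_tk (k := k + 1) (by omega)
  have q0 := h.qd_pos k
  have q1 := h.qd_pos (k + 1)
  rw [he, Nat.add_sub_cancel] at e1
  have e3 : (e + 1) * qd θ (k + 1) = e * qd θ (k + 1) + qd θ (k + 1) := by ring
  have hD : rn θ d (k + 1) + (e * qd θ (k + 1) + qd θ k) = rn θ d (k + 2) := by omega
  obtain ⟨I, Q, h1, h2, h3, h4⟩ := h.sharp_semiconvergent hc hb (e := e) (r := rn θ d (k + 1)) hk
    (by omega) hd (by omega) (by omega)
  have hE : e * qd θ (k + 1) + qd θ k + (rn θ d (k + 2) + qd θ (k + 1)) =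
    rn θ d (k + 2) + (rn θ d (k + 2) + tk θ d (k + 1)) := by omega
  rw [hD] at h2
  rw [hE] at h3 h4
  exact ⟨I, Q, h1, h2, h3, h4⟩

/-- The purely periodic approximation of period `r_{k+2} + t_{k+1}`, which is `e q_{k+1} + q_k` with
`e = a_{k+2} - d_{k+2}`. -/
theorem sharp_long (h : IsCoding pos θ σ d s K) (hc : IsRounding pos Φ) {b : ℕ}
    (hb : 2 ≤ b) {k : ℕ} (hk : K ≤ k) (hd' : 1 ≤ d (k + 2))
    (hd : d (k + 3) < pq θ (k + 3)) :
    IsSharpApprox b (roundingNumber b Φ θ σ) (rn θ d (k + 2) + tk θ d (k + 1))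
      (rn θ d (k + 2) + qd θ (k + 1)) := by
  have hle := h.le (k + 1) (by omega)
  simp only [add_assoc, Nat.reduceAdd] at hle
  obtain ⟨e, he⟩ : ∃ e, pq θ (k + 2) = e + d (k + 2) := ⟨pq θ (k + 2) - d (k + 2), by omega⟩
  have e1 := h.rn_add_two hk
  have e2 := h.rn_add_tk (k := k + 1) (by omega)
  have q0 := h.qd_pos k
  have q1 := h.qd_pos (k + 1)
  have r2 := h.rn_pos (k := k + 2) (by omega)
  rw [he, Nat.add_sub_cancel] at e1
  have e3 : (e + 1) * qd θ (k + 1) = e * qd θ (k + 1) + qd θ (k + 1) := by ring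
  obtain ⟨I, Q, h1, h2, h3, h4⟩ := h.sharp_semiconvergent hc hb (e := e) (r := 0) hk
    (by omega) hd (by omega) (by omega)
  rw [zero_add, ← e1] at h2
  rw [← e1] at h3 h4
  exact ⟨I, Q, h1, h2, h3, h4⟩

/-- The approximation of preperiod `r_{k+2}` and period `q_{k+1}`: after the crossing time
`r_{k+2}`, the next one is `r_{k+2} + q_{k+2}` at the earliest. The error has the exact order when this is
a crossing time. -/
theorem exists_fraction_preperiodic (h : IsCoding pos θ σ d s K) (hc : IsRounding pos Φ) {b : ℕ}
    (hb : 2 ≤ b) {k : ℕ} (hk : K ≤ k) (hd : d (k + 3) < pq θ (k + 3)) (hq : 2 ≤ qd θ (k + 2)) :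
    ∃ (I : ℤ) (Q : ℕ), 0 < Q ∧ Q ≤ b ^ (rn θ d (k + 2) + qd θ (k + 1)) ∧
      |roundingNumber b Φ θ σ - I / Q| ≤ (b : ℝ) ^ 2 / (b : ℝ) ^
        (rn θ d (k + 2) + qd θ (k + 1) + qd θ (k + 2)) ∧
      (Side pos (k + 1) (point θ σ d s (k + 2) + thetaSeq θ (k + 2) + thetaSeq θ (k + 1)) →
        1 / (b : ℝ) ^ (rn θ d (k + 2) + qd θ (k + 1) + qd θ (k + 2)) ≤
          |roundingNumber b Φ θ σ - I / Q|) := by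
  have hv := (side_add_two _ _).1 (h.side_point (k := k + 2) (by omega))
  have hv' := h.side_point_add hc (k := k + 1) (by omega) hd
  have hsg : 0 ≤ (-1) ^ (k + 1) * thetaSeq θ (k + 1) := (h.tau_pos (k + 1)).le
  obtain ⟨I, Q, h1, h2, h3, h4⟩ := hc.exists_fraction hb (σ := σ) h.slope_nonneg h.slope_lt_one
    (N := qd θ (k + 1)) (r := rn θ d (k + 2)) (L := rn θ d (k + 2) + qd θ (k + 2)) (k := k + 1)
    (P := pn θ (k + 1)) (h.qd_pos _) (by omega) hsg (h.tau_lt_one _).le (fun u hu hu' =>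
      h.no_crossing_convergent hc hv hv' (by omega) (by omega) (by omega))
  have hE : qd θ (k + 1) + (rn θ d (k + 2) + qd θ (k + 2)) =
    rn θ d (k + 2) + qd θ (k + 1) + qd θ (k + 2) := by ring
  rw [hE] at h3 h4
  refine ⟨I, Q, h1, h2, h3, fun hs => h4 ((hc.ne_iff hsg _).2
    ⟨s (k + 2) + pn θ (k + 2), ?_, ?_⟩)⟩ <;>
  rw [show ((rn θ d (k + 2) + qd θ (k + 2) : ℕ) : ℝ) * θ + σ -
      ((s (k + 2) + pn θ (k + 2) : ℤ) : ℝ) = point θ σ d s (k + 2) + thetaSeq θ (k + 2) by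
    simp only [point, thetaSeq]; push_cast; ring]
  · refine hc.side_add ((side_add_two _ _).2 hv) ?_
    rw [show k + 1 + 1 = k + 2 by ring]
    exact (h.tau_pos (k + 2)).le
  · exact hs

theorem approx_preperiodic (h : IsCoding pos θ σ d s K) (hc : IsRounding pos Φ) {b : ℕ}
    (hb : 2 ≤ b) {k : ℕ} (hk : K ≤ k) (hd : d (k + 3) < pq θ (k + 3)) (hq : 2 ≤ qd θ (k + 2)) :
    IsApprox b (roundingNumber b Φ θ σ) (rn θ d (k + 2) + qd θ (k + 1)) (qd θ (k + 2)) :=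
  let ⟨I, Q, h1, h2, h3, _⟩ := h.exists_fraction_preperiodic hc hb hk hd hq
  ⟨I, Q, h1, h2, h3⟩

theorem sharp_preperiodic (h : IsCoding pos θ σ d s K) (hc : IsRounding pos Φ) {b : ℕ}
    (hb : 2 ≤ b) {k : ℕ} (hk : K ≤ k) (hq : 2 ≤ qd θ (k + 2))
    (hd : d (k + 3) + 2 ≤ pq θ (k + 3) ∨
      d (k + 3) + 1 = pq θ (k + 3) ∧ d (k + 4) = pq θ (k + 4)) :
    IsSharpApprox b (roundingNumber b Φ θ σ) (rn θ d (k + 2) + qd θ (k + 1)) (qd θ (k + 2)) := by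
  obtain ⟨I, Q, h1, h2, h3, h4⟩ := h.exists_fraction_preperiodic hc hb hk (by omega) hq
  refine ⟨I, Q, h1, h2, h3, h4 ?_⟩
  have hp := h.point_succ_eq (k := k + 2) (by omega)
  have hr := thetaSeq_rec θ (k + 1)
  simp only [add_assoc, Nat.reduceAdd] at hp hr
  have e1 := sign_mul_theta_succ θ (k + 1)
  rcases hd with hd | ⟨hd, hd'⟩
  · -- the point is `y_{k+3}`, moved away from `0` by a multiple of `θ_{k+2}`
    have h1 : (0 : ℝ) ≤ pq θ (k + 3) - 2 - d (k + 3) := by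
      have : (d (k + 3) : ℝ) + 2 ≤ pq θ (k + 3) := by exact_mod_cast hd
      linarith
    rw [show point θ σ d s (k + 2) + thetaSeq θ (k + 2) + thetaSeq θ (k + 1) =
      point θ σ d s (k + 3) + (pq θ (k + 3) - 2 - d (k + 3)) * -thetaSeq θ (k + 2) by
        rw [hp, hr]; ring]
    refine hc.side_add ((side_add_two _ _).1 (h.side_point (k := k + 3) (by omega))) ?_
    have := mul_nonneg h1 (h.tau_pos (k + 2)).le
    have e2 : (-1) ^ (k + 1) * ((pq θ (k + 3) - 2 - d (k + 3)) * -thetaSeq θ (k + 2)) =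
        (pq θ (k + 3) - 2 - d (k + 3)) * tau θ (k + 2) := by
      linear_combination (-(pq θ (k + 3) - 2 - d (k + 3) : ℝ)) * e1
    rw [e2]; exact this
  · -- the next digit vanishes, and the point is `y_{k+4} + θ_{k+3}`
    have hz := h.zero (k + 2) (by omega) hd'
    have h5 : d (k + 5) < pq θ (k + 5) := by
      have hle := h.le (k + 4) (by omega)
      have hz' := h.zero (k + 3) (by omega)
      have := pq_pos h.irrational h.slope_nonneg h.slope_lt_one (k + 3)
      simp only [add_assoc, Nat.reduceAdd] at *
      rcases hle.lt_or_eq with hlt | heq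
      · exact hlt
      · have := hz' heq; omega
    have hs := h.side_point_add hc (k := k + 3) (by omega) h5
    have hp' := h.point_succ_eq (k := k + 3) (by omega)
    have hr' := thetaSeq_rec θ (k + 2)
    simp only [add_assoc, Nat.reduceAdd] at hp' hs hr' hz
    have ha : (pq θ (k + 3) : ℝ) = 1 := by
      have : pq θ (k + 3) = 1 := by omega
      exact_mod_cast this
    rw [hz] at hp
    rw [hd'] at hp'
    rw [ha] at hr
    rw [show point θ σ d s (k + 2) + thetaSeq θ (k + 2) + thetaSeq θ (k + 1) =
      point θ σ d s (k + 4) + thetaSeq θ (k + 3) by rw [hp', hp, hr', hr]; push_cast; ring]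
    exact (side_add_two (k + 1) _).1 hs

end IsCoding

end Sturmian

namespace Sturmian

/-! ### The irrationality exponent from a covering family of approximations -/

theorem le_irrationalityExponent {ξ μ : ℝ}
    (h : {x : ℚ | |ξ - (x : ℝ)| < 1 / (x.den : ℝ) ^ μ}.Infinite) :
    (μ : EReal) ≤ irrationalityExponent ξ :=
  le_iSup₂_of_le μ h le_rfl

theorem two_le_irrationalityExponent {ξ : ℝ} (hξ : Irrational ξ) :
    (2 : ℝ) ≤ irrationalityExponent ξ := by
  refine le_irrationalityExponent ?_
  simpa using Real.infinite_rat_abs_sub_lt_one_div_den_sq_of_irrational hξ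

theorem den_le_of_eq_div {I : ℤ} {Q : ℕ} (hQ : 0 < Q) : (((I : ℚ) / (Q : ℚ)).den : ℕ) ≤ Q := by
  have h := Rat.den_dvd I Q
  rw [Rat.divInt_eq_div] at h
  exact Nat.le_of_dvd hQ (by exact_mod_cast h)

/-- Approximations of quality `(D, E)` bound the irrationality exponent from below by the upper
limit of `1 + E / D`; indices with `E ≤ D` are harmless, as the exponent is at least `2`. -/
theorem limsup_le_irrationalityExponent {b : ℕ} (hb : 2 ≤ b) {ξ : ℝ} (hξ : Irrational ξ)
    {l : Filter ℕ} {D E : ℕ → ℕ} (hD : Tendsto D l atTop) {f : ℕ → ℝ}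
    (hf : ∀ᶠ k in l, f k ≤ 1 + (E k : ℝ) / D k)
    (h : ∀ᶠ k in l, E k ≤ D k ∨ IsApprox b ξ (D k) (E k)) :
    limsup (fun k => (f k : EReal)) l ≤ irrationalityExponent ξ := by
  by_contra! hlt
  obtain ⟨μ, hμ, hμ'⟩ := EReal.lt_iff_exists_real_btwn.1 hlt
  obtain ⟨μ₁, hμ₁, hμ₁'⟩ := EReal.lt_iff_exists_real_btwn.1 hμ'
  have h2 : 2 < μ := by exact_mod_cast (two_le_irrationalityExponent hξ).trans_lt hμ
  have h12 : μ < μ₁ := by exact_mod_cast hμ₁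
  refine absurd (le_irrationalityExponent (μ := μ) ?_) (not_le.2 hμ)
  have hfr : ∃ᶠ k in l, (μ₁ : EReal) < f k := frequently_lt_of_lt_limsup (by isBoundedDefault) hμ₁'
  have hb1 : (1 : ℝ) < b := by exact_mod_cast (by omega : 1 < b)
  have hb0 : (0 : ℝ) < b := by linarith
  have hclose : ∀ ε : ℝ, 0 < ε → ∃ x : ℚ, |ξ - (x : ℝ)| < 1 / (x.den : ℝ) ^ μ ∧ |ξ - x| < ε := by
    intro ε hε
    have hpow : ∀ᶠ n : ℕ in atTop, (b : ℝ) ^ 2 * ((b : ℝ) ^ n)⁻¹ < ε := by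
      have : Tendsto (fun n : ℕ => (b : ℝ) ^ 2 * ((b : ℝ) ^ n)⁻¹) atTop (nhds ((b : ℝ) ^ 2 * 0)) :=
        (tendsto_inv_atTop_zero.comp (tendsto_pow_atTop_atTop_of_one_lt hb1)).const_mul _
      rw [mul_zero] at this
      exact this.eventually_lt_const hε
    have hbig : ∀ᶠ n : ℕ in atTop, 2 < (n : ℝ) * (μ₁ - μ) :=
      (tendsto_natCast_atTop_atTop.atTop_mul_const (by linarith)).eventually_gt_atTop 2
    obtain ⟨k, hk, hfk, hk', hk1, hk2, hk3⟩ := (hfr.and_eventually (hf.and (h.and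
      ((hD.eventually hpow).and ((hD.eventually hbig).and
        (hD.eventually (eventually_ge_atTop 1))))))).exists
    have hk0 : μ₁ < f k := by exact_mod_cast hk
    have hDpos : (0 : ℝ) < D k := by exact_mod_cast (by omega : 0 < D k)
    have hratio : μ₁ * D k < D k + E k := by
      have h3 : μ₁ < 1 + (E k : ℝ) / D k := hk0.trans_le hfk
      have h4 : (1 + (E k : ℝ) / D k) * D k = D k + E k := by field_simp
      rw [← h4]; exact mul_lt_mul_of_pos_right h3 hDpos
    have hED : ¬ E k ≤ D k := by
      intro hle
      have : (E k : ℝ) ≤ D k := by exact_mod_cast hle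
      nlinarith
    obtain ⟨I, Q, hQ0, hQ, herr⟩ := hk'.resolve_left hED
    refine ⟨(I : ℚ) / (Q : ℚ), ?_, ?_⟩
    · push_cast
      refine herr.trans_lt ?_
      have hden : ((((I : ℚ) / (Q : ℚ)).den : ℕ) : ℝ) ≤ (b : ℝ) ^ (D k) := by
        exact_mod_cast (den_le_of_eq_div hQ0).trans hQ
      have hden0 : (0 : ℝ) < ((((I : ℚ) / (Q : ℚ)).den : ℕ) : ℝ) := by
        exact_mod_cast Rat.den_pos _
      have h5 : ((((I : ℚ) / (Q : ℚ)).den : ℕ) : ℝ) ^ μ ≤ (b : ℝ) ^ ((D k : ℝ) * μ) := by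
        rw [Real.rpow_mul hb0.le, Real.rpow_natCast]
        exact Real.rpow_le_rpow hden0.le hden (by linarith)
      refine lt_of_lt_of_le ?_ (one_div_le_one_div_of_le (Real.rpow_pos_of_pos hden0 _) h5)
      rw [← Real.rpow_natCast, ← Real.rpow_natCast, ← Real.rpow_sub hb0, one_div,
        ← Real.rpow_neg hb0.le]
      refine Real.rpow_lt_rpow_of_exponent_lt hb1 ?_
      push_cast
      linarith
    · push_cast
      refine herr.trans_lt (lt_of_le_of_lt ?_ hk1)
      rw [div_eq_mul_inv, pow_add]
      gcongr
      exact le_mul_of_one_le_right (by positivity) (one_le_pow₀ hb1.le)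
  intro hfin
  have hpos : ∀ x : ℚ, 0 < |ξ - (x : ℝ)| := fun x =>
    abs_pos.2 (sub_ne_zero.2 (hξ.ne_rat x))
  obtain ⟨x₀, hx₀, -⟩ := hclose 1 one_pos
  obtain ⟨x, hx, hmin⟩ := Set.exists_min_image _ (fun x : ℚ => |ξ - (x : ℝ)|) hfin ⟨x₀, hx₀⟩
  obtain ⟨y, hy, hy'⟩ := hclose _ (hpos x)
  exact (hmin y hy).not_gt hy'

/-- A sharp approximation `I / Q` of quality `(D, E)` governs all the rationals of denominator about
`b^N` with `D ≤ N ≤ E`: they differ from `I / Q` by at least `1 / (Q q)`, or are equal to it. -/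
theorem IsSharpApprox.lower_bound {b : ℕ} (hb : 2 ≤ b) {ξ : ℝ} {D E N : ℕ}
    (h : IsSharpApprox b ξ D E) (hN : N ≤ E) (x : ℚ) (hx : 2 * b ^ 2 * x.den ≤ b ^ N) :
    1 / (2 * x.den * (b : ℝ) ^ D) ≤ |ξ - x| ∨ 1 / (b : ℝ) ^ (D + E) ≤ |ξ - x| := by
  obtain ⟨I, Q, hQ0, hQ, hup, hlow⟩ := h
  have hb1 : (1 : ℝ) ≤ b := by exact_mod_cast (by omega : 1 ≤ b)
  have hb0 : (0 : ℝ) < b := by linarith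
  have hQR : (0 : ℝ) < Q := by exact_mod_cast hQ0
  have hq : (0 : ℝ) < x.den := by exact_mod_cast x.den_pos
  have hxc : (x : ℝ) = x.num / x.den := by exact_mod_cast (Rat.num_div_den x).symm
  by_cases heq : x.num * Q = I * x.den
  · right
    have : (x : ℝ) = I / Q := by
      rw [hxc, div_eq_div_iff hq.ne' hQR.ne']; exact_mod_cast heq
    rwa [this]
  · left
    have h1 : (1 : ℝ) ≤ |(x.num : ℝ) * Q - I * x.den| := by
      have : (1 : ℤ) ≤ |x.num * Q - I * x.den| := Int.one_le_abs (sub_ne_zero.2 heq)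
      exact_mod_cast this
    have h2 : 1 / (x.den * (b : ℝ) ^ D) ≤ |(x : ℝ) - I / Q| := by
      have h3 : (x : ℝ) - I / Q = ((x.num : ℝ) * Q - I * x.den) / (x.den * Q) := by
        rw [hxc]; field_simp
      rw [h3, abs_div, abs_of_pos (mul_pos hq hQR)]
      have : (Q : ℝ) ≤ (b : ℝ) ^ D := by exact_mod_cast hQ
      gcongr
    have h4 : (b : ℝ) ^ 2 / (b : ℝ) ^ (D + E) ≤ 1 / (2 * x.den * (b : ℝ) ^ D) := by
      have h5 : (2 : ℝ) * b ^ 2 * x.den ≤ (b : ℝ) ^ E := by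
        calc (2 : ℝ) * b ^ 2 * x.den ≤ (b : ℝ) ^ N := by exact_mod_cast hx
          _ ≤ (b : ℝ) ^ E := pow_le_pow_right₀ hb1 hN
      rw [div_le_div_iff₀ (by positivity) (by positivity), pow_add]
      calc (b : ℝ) ^ 2 * (2 * x.den * (b : ℝ) ^ D) = 2 * b ^ 2 * x.den * (b : ℝ) ^ D := by ring
        _ ≤ (b : ℝ) ^ E * (b : ℝ) ^ D := by gcongr
        _ = 1 * ((b : ℝ) ^ D * (b : ℝ) ^ E) := by ring
    have h6 : 1 / (x.den * (b : ℝ) ^ D) =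
        1 / (2 * x.den * (b : ℝ) ^ D) + 1 / (2 * x.den * (b : ℝ) ^ D) := by
      field_simp; norm_num
    have h7 : |(x : ℝ) - I / Q| ≤ |ξ - I / Q| + |ξ - x| := by
      rw [show (x : ℝ) - I / Q = (ξ - I / Q) - (ξ - x) by ring]
      exact abs_sub _ _
    linarith

theorem irrational_of_sharpApprox {b : ℕ} (hb : 2 ≤ b) {ξ : ℝ} {N₀ : ℕ}
    (h : ∀ N, N₀ ≤ N → ∃ D E, N ≤ E ∧ IsSharpApprox b ξ D E) : Irrational ξ := by
  rintro ⟨x, rfl⟩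
  have hb0 : (0 : ℝ) < b := by positivity
  have hq : (0 : ℝ) < x.den := by exact_mod_cast x.den_pos
  obtain ⟨D, E, hE, hs⟩ := h (N₀ + 2 * b ^ 2 * x.den) (by omega)
  have hx : 2 * b ^ 2 * x.den ≤ b ^ (N₀ + 2 * b ^ 2 * x.den) :=
    (Nat.lt_pow_self (by omega)).le.trans (Nat.pow_le_pow_right (by omega) (Nat.le_add_left _ _))
  have h3 : 0 < 1 / (2 * x.den * (b : ℝ) ^ D) := by positivity
  have h4 : 0 < 1 / (b : ℝ) ^ (D + E) := by positivity
  rcases hs.lower_bound hb hE x hx with h1 | h1 <;>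
  · rw [sub_self, abs_zero] at h1; linarith

theorem finite_rat_near (ξ : ℝ) {μ : ℝ} (hμ : 0 ≤ μ) (X : ℕ) :
    {x : ℚ | |ξ - (x : ℝ)| < 1 / (x.den : ℝ) ^ μ ∧ x.den < X}.Finite := by
  obtain ⟨B, hB⟩ := exists_nat_gt ((|ξ| + 1) * X)
  refine Set.Finite.subset (Set.Finite.image (fun p : ℤ × ℕ => (p.1 : ℚ) / (p.2 : ℚ))
    ((Finset.Icc (-(B : ℤ)) B ×ˢ Finset.range X).finite_toSet)) ?_
  rintro x ⟨hx, hX⟩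
  refine ⟨(x.num, x.den), ?_, Rat.num_div_den x⟩
  have hq : (1 : ℝ) ≤ x.den := by exact_mod_cast x.den_pos
  have h1 : 1 / (x.den : ℝ) ^ μ ≤ 1 := by
    rw [div_le_one (by positivity)]
    exact Real.one_le_rpow hq hμ
  have h2 : |(x : ℝ)| ≤ |ξ| + 1 := by
    have := abs_sub_abs_le_abs_sub (x : ℝ) ξ
    rw [abs_sub_comm] at this
    linarith
  have hxc : (x.num : ℝ) = x * x.den := by exact_mod_cast (Rat.mul_den_eq_num x).symm
  have h3 : |(x.num : ℝ)| ≤ B := by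
    rw [hxc, abs_mul, abs_of_pos (by linarith : (0 : ℝ) < x.den)]
    have : (x.den : ℝ) ≤ X := by exact_mod_cast hX.le
    calc |(x : ℝ)| * x.den ≤ (|ξ| + 1) * X := by gcongr
      _ ≤ B := hB.le
  have h4 : |x.num| ≤ (B : ℤ) := by exact_mod_cast h3
  simp only [Finset.coe_product, Finset.coe_Icc, Finset.coe_range, Set.mem_prod, Set.mem_Icc,
    Set.mem_Iio]
  exact ⟨abs_le.1 h4, hX⟩

/-- If sharp approximations of quality `(D, E)` with `D + E ≤ μ D` cover all the large integers by
their intervals `[D, E]`, then the irrationality exponent is at most `μ`. -/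
theorem irrationalityExponent_le {b : ℕ} (hb : 2 ≤ b) {ξ μ : ℝ} {N₀ : ℕ}
    (h : ∀ N, N₀ ≤ N → ∃ D E, 0 < D ∧ D ≤ N ∧ N ≤ E ∧ (D : ℝ) + E ≤ μ * D ∧
      IsSharpApprox b ξ D E) : irrationalityExponent ξ ≤ μ := by
  have hb2 : (2 : ℝ) ≤ b := by exact_mod_cast hb
  have hb0 : (0 : ℝ) < b := by linarith
  have hμ2 : 2 ≤ μ := by
    obtain ⟨D, E, hD, hDN, hNE, hle, -⟩ := h N₀ le_rfl
    have h1 : (D : ℝ) ≤ E := by exact_mod_cast hDN.trans hNE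
    have h2 : (0 : ℝ) < D := by exact_mod_cast hD
    by_contra! hc
    nlinarith
  have key : ∀ x : ℚ, b ^ N₀ ≤ x.den →
      (b : ℝ) ^ (-(4 * μ)) * (1 / (x.den : ℝ) ^ μ) ≤ |ξ - x| := by
    intro x hx
    have hq : (1 : ℝ) ≤ x.den := by exact_mod_cast x.den_pos
    have hq0 : (0 : ℝ) < x.den := by linarith
    -- the shift by `4` makes `b^N` larger than `2 b^2 q`, as `IsSharpApprox.lower_bound` requires
    set M := Nat.log b x.den with hM
    have hM1 : b ^ M ≤ x.den := Nat.pow_log_le_self b x.den_pos.ne'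
    have hM2 : x.den < b ^ (M + 1) := Nat.lt_pow_succ_log_self (by omega) _
    have hNM : N₀ ≤ M := Nat.le_log_of_pow_le (by omega) hx
    obtain ⟨D, E, hD, hDN, hNE, hle, hs⟩ := h (M + 4) (by omega)
    have hbx : 2 * b ^ 2 * x.den ≤ b ^ (M + 4) := by
      calc 2 * b ^ 2 * x.den ≤ b * b ^ 2 * b ^ (M + 1) := by gcongr
        _ = b ^ (M + 4) := by ring
    have hpow : (b : ℝ) ^ D ≤ (b : ℝ) ^ 4 * x.den := by
      calc (b : ℝ) ^ D ≤ (b : ℝ) ^ (M + 4) := pow_le_pow_right₀ (by linarith) hDN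
        _ = (b : ℝ) ^ 4 * (b : ℝ) ^ M := by ring
        _ ≤ (b : ℝ) ^ 4 * x.den := by
          gcongr
          exact_mod_cast hM1
    have hpμ : (b : ℝ) ^ (-(4 * μ)) * (1 / (x.den : ℝ) ^ μ) = 1 / ((b : ℝ) ^ 4 * x.den) ^ μ := by
      rw [Real.mul_rpow (by positivity) hq0.le, ← Real.rpow_natCast, ← Real.rpow_mul hb0.le,
        Real.rpow_neg hb0.le]
      push_cast
      rw [one_div, one_div, mul_inv]
    have hbase : 1 ≤ (b : ℝ) ^ 4 * x.den := by
      have : 1 ≤ (b : ℝ) ^ 4 := one_le_pow₀ (by linarith)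
      nlinarith
    rw [hpμ]
    rcases hs.lower_bound hb hNE x hbx with h1 | h1
    · refine le_trans (one_div_le_one_div_of_le (by positivity) ?_) h1
      calc 2 * x.den * (b : ℝ) ^ D ≤ (b : ℝ) ^ 4 * x.den * ((b : ℝ) ^ 4 * x.den) := by
            gcongr
            calc (2 : ℝ) ≤ b := hb2
              _ ≤ (b : ℝ) ^ 4 := le_self_pow₀ (by linarith) (by norm_num)
        _ = ((b : ℝ) ^ 4 * x.den) ^ (2 : ℝ) := by rw [← pow_two]; norm_cast
        _ ≤ _ := Real.rpow_le_rpow_of_exponent_le hbase hμ2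
    · refine le_trans (one_div_le_one_div_of_le (by positivity) ?_) h1
      calc (b : ℝ) ^ (D + E) = (b : ℝ) ^ ((D : ℝ) + E) := by
            rw [← Real.rpow_natCast]; push_cast; rfl
        _ ≤ (b : ℝ) ^ ((D : ℝ) * μ) :=
          Real.rpow_le_rpow_of_exponent_le (by linarith) (by linarith)
        _ = ((b : ℝ) ^ D) ^ μ := by rw [Real.rpow_mul hb0.le, Real.rpow_natCast]
        _ ≤ _ := Real.rpow_le_rpow (by positivity) hpow (by linarith)
  refine iSup₂_le fun ν hν => ?_
  by_contra! hlt
  have hμν : μ < ν := by exact_mod_cast hlt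
  obtain ⟨X, hX⟩ : ∃ X : ℕ, ∀ n : ℕ, X ≤ n → (b : ℝ) ^ (4 * μ) < (n : ℝ) ^ (ν - μ) :=
    eventually_atTop.1 (((tendsto_rpow_atTop (by linarith : 0 < ν - μ)).comp
      tendsto_natCast_atTop_atTop).eventually_gt_atTop _)
  refine hν ((finite_rat_near ξ (by linarith : 0 ≤ ν) (X + b ^ N₀)).subset fun x hx => ⟨hx, ?_⟩)
  by_contra! hc
  have h1 := (key x (by omega)).trans_lt hx
  have h2 := hX x.den (by omega)
  have hq0 : (0 : ℝ) < x.den := by exact_mod_cast x.den_pos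
  rw [Real.rpow_sub hq0, lt_div_iff₀ (by positivity)] at h2
  rw [Real.rpow_neg hb0.le, ← one_div, one_div_mul_one_div,
    one_div_lt_one_div (by positivity) (by positivity)] at h1
  linarith

end Sturmian

namespace Sturmian

namespace IsCoding

variable {pos : ℝ → Prop} {Φ : ℝ → ℤ} {θ σ : ℝ} {d : ℕ → ℕ} {s : ℕ → ℤ} {K : ℕ}

/-! ### The exponent of a coded number -/

theorem lt_of_eq (h : IsCoding pos θ σ d s K) {k : ℕ} (hk : K ≤ k)
    (hd : d (k + 1) = pq θ (k + 1)) : d (k + 2) < pq θ (k + 2) := by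
  have h1 := h.le (k + 1) (by omega)
  have h2 := h.zero k hk
  have h3 := pq_pos h.irrational h.slope_nonneg h.slope_lt_one k
  rcases h1.lt_or_eq with hlt | heq
  · exact hlt
  · have := h2 heq; omega

theorem tk_succ_of_eq (h : IsCoding pos θ σ d s K) {k : ℕ} (hk : K ≤ k)
    (hd : d (k + 2) = pq θ (k + 2)) : tk θ d (k + 1) = tk θ d k := by
  rw [tk_succ, h.zero k hk hd, zero_mul, add_zero]

/-- When `d_{k+3}` is maximal, the first crossing time of the period `q_{k+1}` is no longer
`r_{k+2}` but `r_{k+3} + q_{k+2}`: the approximation is one of the family `sharp_long`, for `e = 0`. -/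
theorem sharp_convergent_of_eq (h : IsCoding pos θ σ d s K) (hc : IsRounding pos Φ) {b : ℕ}
    (hb : 2 ≤ b) {k : ℕ} (hk : K ≤ k) (hd : d (k + 3) = pq θ (k + 3)) :
    IsSharpApprox b (roundingNumber b Φ θ σ) (rn θ d (k + 3) + tk θ d (k + 2))
      (rn θ d (k + 3) + qd θ (k + 2)) ∧ rn θ d (k + 3) + tk θ d (k + 2) = qd θ (k + 1) := by
  have h1 := h.lt_of_eq (k := k + 2) (by omega) hd
  have h2 := pq_pos h.irrational h.slope_nonneg h.slope_lt_one (k + 2)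
  have h3 := h.rn_add_two (k := k + 1) (by omega)
  simp only [add_assoc, Nat.reduceAdd] at *
  rw [hd, Nat.sub_self, zero_mul, zero_add] at h3
  exact ⟨h.sharp_long hc hb (k := k + 1) (by omega) (by simp only [add_assoc, Nat.reduceAdd]; omega)
    h1, h3⟩

theorem le_or_approx_convergent (h : IsCoding pos θ σ d s K) (hc : IsRounding pos Φ) {b : ℕ}
    (hb : 2 ≤ b) {k : ℕ} (hk : K ≤ k) : rn θ d (k + 2) ≤ qd θ (k + 1) ∨
      IsApprox b (roundingNumber b Φ θ σ) (qd θ (k + 1)) (rn θ d (k + 2)) := by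
  rcases (h.le (k + 2) (by omega)).lt_or_eq with hlt | heq
  · rcases Nat.lt_or_ge (rn θ d (k + 2)) 2 with h2 | h2
    · have := h.qd_pos (k + 1); omega
    · exact Or.inr (h.sharp_convergent hc hb hk hlt h2).isApprox
  · obtain ⟨h1, h2⟩ := h.sharp_convergent_of_eq hc hb hk heq
    rw [h2] at h1
    have := h.rn_add_tk (k := k + 2) (by omega)
    exact Or.inr (h1.isApprox.mono hb (by omega))

theorem le_or_approx_long (h : IsCoding pos θ σ d s K) (hc : IsRounding pos Φ) {b : ℕ}
    (hb : 2 ≤ b) {k : ℕ} (hk : K ≤ k) (hd : d (k + 3) < pq θ (k + 3)) :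
    rn θ d (k + 2) + qd θ (k + 1) ≤ rn θ d (k + 2) + tk θ d (k + 1) ∨
      IsApprox b (roundingNumber b Φ θ σ) (rn θ d (k + 2) + tk θ d (k + 1))
        (rn θ d (k + 2) + qd θ (k + 1)) := by
  rcases Nat.eq_zero_or_pos (d (k + 2)) with h0 | h0
  · -- the period is `q_{k+2}`, for which a better approximation is known
    have e1 := h.rn_add_two hk
    have e2 := h.rn_add_two (k := k + 1) (by omega)
    have e3 := tk_succ θ d (k + 1)
    have e4 := h.rn_add_tk (k := k + 1) (by omega)
    have e5 := h.rn_add_tk (k := k + 2) (by omega)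
    obtain ⟨e, he⟩ : ∃ e, pq θ (k + 3) = d (k + 3) + (e + 1) :=
      ⟨pq θ (k + 3) - d (k + 3) - 1, by omega⟩
    simp only [add_assoc, Nat.reduceAdd] at *
    rw [h0, zero_mul, add_zero] at e3
    rw [he, Nat.add_sub_cancel_left, add_mul, one_mul] at e2
    have hq : qd θ (k + 2) = rn θ d (k + 2) + tk θ d (k + 1) := by omega
    rcases h.le_or_approx_convergent hc hb (k := k + 1) (by omega) with h1 | h1
    · simp only [add_assoc, Nat.reduceAdd] at h1
      left; omega
    · simp only [add_assoc, Nat.reduceAdd] at h1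
      right
      rw [← hq]
      exact h1.mono hb (by omega)
  · exact Or.inr (h.sharp_long hc hb hk h0 hd).isApprox

theorem le_or_approx_preperiodic (h : IsCoding pos θ σ d s K) (hc : IsRounding pos Φ) {b : ℕ}
    (hb : 2 ≤ b) {k : ℕ} (hk : K ≤ k) (hq : 2 ≤ qd θ (k + 2)) :
    qd θ (k + 2) ≤ rn θ d (k + 2) + qd θ (k + 1) ∨
      IsApprox b (roundingNumber b Φ θ σ) (rn θ d (k + 2) + qd θ (k + 1)) (qd θ (k + 2)) := by
  rcases (h.le (k + 2) (by omega)).lt_or_eq with hlt | heq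
  · exact Or.inr (h.approx_preperiodic hc hb hk hlt hq)
  · have e1 := h.tk_succ_of_eq (k := k + 1) (by omega) heq
    have e4 := h.rn_add_tk (k := k + 1) (by omega)
    have e5 := h.rn_add_tk (k := k + 2) (by omega)
    simp only [add_assoc, Nat.reduceAdd] at *
    left; omega

/-- The sharp approximations of the four families cover all the large integers. In general the
interval `[q_{j+1}, q_{j+2}]` is cut at `r_{j+2}`, `r_{j+2} + t_{j+1}` and `r_{j+2} + q_{j+1}`, and
each part is covered by one family. -/
theorem exists_sharp_cover (h : IsCoding pos θ σ d s K) (hc : IsRounding pos Φ) {b : ℕ}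
    (hb : 2 ≤ b) {j N : ℕ} (hj : K ≤ j) (hq : 2 ≤ qd θ (j + 1)) (hN : qd θ (j + 1) ≤ N)
    (hN' : N ≤ qd θ (j + 2)) :
    ∃ D E, D ≤ N ∧ N ≤ E ∧ IsSharpApprox b (roundingNumber b Φ θ σ) D E ∧ ∃ k, j ≤ k ∧
      ((d (k + 2) < pq θ (k + 2) ∧ d (k + 3) < pq θ (k + 3) ∧ D = rn θ d (k + 2) ∧
          E = rn θ d (k + 2) + tk θ d (k + 1)) ∨
        (d (k + 3) < pq θ (k + 3) ∧ D = rn θ d (k + 2) + tk θ d (k + 1) ∧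
          E = rn θ d (k + 2) + qd θ (k + 1)) ∨
        (D = rn θ d (k + 2) + qd θ (k + 1) ∧ E = qd θ (k + 2)) ∨
        (D = qd θ (k + 1) ∧ E = rn θ d (k + 2))) := by
  have hmono := qd_le_succ h.irrational h.slope_nonneg h.slope_lt_one
  have hle3 := h.le (k := j + 2) (by omega)
  have hle2 := h.le (k := j + 1) (by omega)
  have hle4 := h.le (k := j + 3) (by omega)
  have e1 := h.rn_add_two hj
  have e2 := h.rn_add_two (k := j + 1) (by omega)
  have e3 := tk_succ θ d (j + 1)
  have e4 := h.rn_add_tk (k := j + 1) (by omega)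
  have e5 := h.rn_add_tk (k := j + 2) (by omega)
  have m1 := hmono j
  have m2 := hmono (j + 1)
  simp only [add_assoc, Nat.reduceAdd] at *
  rcases hle3.lt_or_eq with hlt | heq
  swap
  · -- a single approximation covers the whole interval
    obtain ⟨h1, h2⟩ := h.sharp_convergent_of_eq hc hb hj heq
    exact ⟨_, _, by omega, by omega, h1, j + 1, by omega, Or.inr (Or.inl
      ⟨by simpa only [add_assoc, Nat.reduceAdd] using h.lt_of_eq (k := j + 2) (by omega) heq,
        rfl, rfl⟩)⟩
  rcases Nat.lt_or_ge (rn θ d (j + 2)) N with hr | hr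
  swap
  · exact ⟨_, _, hN, hr, h.sharp_convergent hc hb hj hlt (by omega), j, le_rfl,
      Or.inr (Or.inr (Or.inr ⟨rfl, rfl⟩))⟩
  rcases Nat.eq_zero_or_pos (d (j + 2)) with h0 | h0
  · have hd : d (j + 2) < pq θ (j + 2) := by
      rw [h0]; exact pq_pos h.irrational h.slope_nonneg h.slope_lt_one (j + 1)
    rw [h0, zero_mul] at e3
    exact ⟨_, _, hr.le, by omega, h.sharp_short hc hb hj hd hlt, j, le_rfl,
      Or.inl ⟨hd, hlt, rfl, rfl⟩⟩
  rcases Nat.lt_or_ge N (rn θ d (j + 2) + tk θ d (j + 1)) with ht | ht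
  · have hd : d (j + 2) < pq θ (j + 2) := by
      refine lt_of_le_of_ne hle2 fun heq => ?_
      rw [heq, Nat.sub_self, zero_mul] at e1
      omega
    exact ⟨_, _, hr.le, ht.le, h.sharp_short hc hb hj hd hlt, j, le_rfl,
      Or.inl ⟨hd, hlt, rfl, rfl⟩⟩
  rcases Nat.lt_or_ge (rn θ d (j + 2) + qd θ (j + 1)) N with hq' | hq'
  swap
  · exact ⟨_, _, ht, hq', h.sharp_long hc hb hj h0 hlt, j, le_rfl,
      Or.inr (Or.inl ⟨hlt, rfl, rfl⟩)⟩
  by_cases hs : d (j + 3) + 2 ≤ pq θ (j + 3) ∨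
      d (j + 3) + 1 = pq θ (j + 3) ∧ d (j + 4) = pq θ (j + 4)
  · exact ⟨_, _, hq'.le, hN', h.sharp_preperiodic hc hb hj (by omega) hs, j, le_rfl,
      Or.inr (Or.inr (Or.inl ⟨rfl, rfl⟩))⟩
  · -- here `r_{j+3} = r_{j+2} + q_{j+1}`, and the first family at the next index takes over
    have h3 : d (j + 3) + 1 = pq θ (j + 3) := by omega
    have h4 : d (j + 4) < pq θ (j + 4) := by omega
    rw [← h3, Nat.add_sub_cancel_left, one_mul] at e2
    exact ⟨rn θ d (j + 3), rn θ d (j + 3) + tk θ d (j + 2), by omega, by omega,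
      h.sharp_short hc hb (k := j + 1) (by omega) hlt h4, j + 1, by omega,
      Or.inl ⟨hlt, h4, rfl, rfl⟩⟩

theorem nuSeq₁_eq (h : IsCoding pos θ σ d s K) {k : ℕ} (hk : K ≤ k) :
    nuSeq₁ θ d k = 1 + ((rn θ d (k + 1) + tk θ d k : ℕ) : ℝ) / (rn θ d (k + 1) : ℕ) := by
  have hr : (0 : ℝ) < rn θ d (k + 1) := by exact_mod_cast h.rn_pos (k := k + 1) (by omega)
  rw [nuSeq₁, h.rk_eq (by omega)]
  push_cast
  field_simp
  ring

theorem nuSeq₂_eq (h : IsCoding pos θ σ d s K) {k : ℕ} (hk : K ≤ k) :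
    nuSeq₂ θ d k = 1 + ((rn θ d (k + 1) + qd θ k : ℕ) : ℝ) / (rn θ d (k + 1) + tk θ d k : ℕ) := by
  have hr : (0 : ℝ) < rn θ d (k + 1) := by exact_mod_cast h.rn_pos (k := k + 1) (by omega)
  rw [nuSeq₂, h.rk_eq hk, h.rk_eq (k := k + 1) (by omega), ← h.rn_add_tk hk]
  push_cast
  field_simp
  ring

theorem nuSeq₃_eq (h : IsCoding pos θ σ d s K) {k : ℕ} (hk : K ≤ k) :
    nuSeq₃ θ d k = 1 + (qd θ (k + 1) : ℝ) / (rn θ d (k + 1) + qd θ k : ℕ) := by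
  rw [nuSeq₃, h.rk_eq (by omega)]
  push_cast; rfl

theorem nuSeq₄_eq (h : IsCoding pos θ σ d s K) {k : ℕ} (hk : K ≤ k) :
    nuSeq₄ θ d k = 1 + (rn θ d (k + 2) : ℝ) / (qd θ (k + 1) : ℕ) := by
  rw [nuSeq₄, h.rk_eq (by omega)]
  push_cast; rfl

theorem le_rn (h : IsCoding pos θ σ d s K) {k : ℕ} (hk : K ≤ k) (hd : d (k + 2) < pq θ (k + 2)) :
    k ≤ rn θ d (k + 2) := by
  have e1 := h.rn_add_two hk
  have e2 := h.tk_lt (k + 1) (by omega)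
  have e3 := le_qd h.irrational h.slope_nonneg h.slope_lt_one k
  have : 1 * qd θ (k + 1) ≤ (pq θ (k + 2) - d (k + 2)) * qd θ (k + 1) :=
    Nat.mul_le_mul_right _ (by omega)
  omega

theorem le_rn_add_tk (h : IsCoding pos θ σ d s K) {k : ℕ} (hk : K ≤ k) :
    k ≤ rn θ d (k + 2) + tk θ d (k + 1) := by
  rw [h.rn_add_two hk]
  have e3 := le_qd h.irrational h.slope_nonneg h.slope_lt_one k
  omega

theorem exists_cover (h : IsCoding pos θ σ d s K) {J : ℕ} {N : ℕ} (hN : qd θ (J + 1) ≤ N) :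
    ∃ j, J ≤ j ∧ qd θ (j + 1) ≤ N ∧ N ≤ qd θ (j + 2) := by
  have hex : ∃ i, N ≤ qd θ (J + i + 2) :=
    ⟨N, (le_qd h.irrational h.slope_nonneg h.slope_lt_one N).trans
      (monotone_qd h.irrational h.slope_nonneg h.slope_lt_one (by omega))⟩
  classical
  refine ⟨J + Nat.find hex, by omega, ?_, Nat.find_spec hex⟩
  rcases Nat.eq_zero_or_pos (Nat.find hex) with h0 | h0
  · rw [h0]; exact hN
  · have := Nat.find_min hex (m := Nat.find hex - 1) (by omega)
    rw [show J + (Nat.find hex - 1) + 2 = J + Nat.find hex + 1 by omega] at this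
    omega

/-- The irrationality exponent of a coded number. -/
theorem irrationalityExponent_eq (h : IsCoding pos θ σ d s K) (hc : IsRounding pos Φ) {b : ℕ}
    (hb : 2 ≤ b) : irrationalityExponent (roundingNumber b Φ θ σ) =
      max (max (nu₁ θ d) (nu₂ θ d)) (max (nu₃ θ d) (nu₄ θ d)) := by
  have hq2 : ∀ k, 2 ≤ k → 2 ≤ qd θ k := fun k hk =>
    hk.trans (le_qd h.irrational h.slope_nonneg h.slope_lt_one k)
  have hirr : Irrational (roundingNumber b Φ θ σ) := by
    refine irrational_of_sharpApprox hb (N₀ := qd θ (K + 1 + 1)) fun N hN => ?_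
    obtain ⟨j, hj, hj1, hj2⟩ := h.exists_cover hN
    obtain ⟨D, E, h1, h2, h3, -⟩ := h.exists_sharp_cover hc hb (by omega) (hq2 _ (by omega)) hj1 hj2
    exact ⟨D, E, h2, h3⟩
  have htend : ∀ {l : Filter ℕ} {D : ℕ → ℕ}, l ≤ atTop → (∀ᶠ k in l, k ≤ D k + 1) →
      Tendsto D l atTop := fun {l D} hl hD => by
    have h1 : Tendsto (fun k : ℕ => k - 1) atTop atTop := tendsto_sub_atTop_nat 1
    exact tendsto_atTop_mono' _ (hD.mono fun k hk => by change k - 1 ≤ D k; omega) (h1.mono_left hl)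
  have hge : ∀ {l : Filter ℕ}, l ≤ atTop → ∀ᶠ k in l, ∃ j, k = j + 1 ∧ K + 2 ≤ j := fun hl =>
    ((eventually_ge_atTop (K + 3)).filter_mono hl).mono fun k hk => ⟨k - 1, by omega, by omega⟩
  have hinf : ∀ {S : Set ℕ}, (atTop ⊓ 𝓟 S : Filter ℕ) ≤ atTop := fun {_} =>
    inf_le_left
  apply le_antisymm
  · -- a real number above the four upper limits bounds all the ratios of large index
    by_contra! hlt
    obtain ⟨μ, hμ, hμ'⟩ := EReal.lt_iff_exists_real_btwn.1 hlt
    refine absurd hμ' (not_lt.2 ?_)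
    simp only [max_lt_iff] at hμ
    obtain ⟨⟨hμ1, hμ2⟩, hμ3, hμ4⟩ := hμ
    have l1 := eventually_lt_of_limsup_lt hμ1
    have l2 := eventually_lt_of_limsup_lt hμ2
    have l3 := eventually_lt_of_limsup_lt hμ3
    have l4 := eventually_lt_of_limsup_lt hμ4
    rw [eventually_inf_principal] at l1 l2
    obtain ⟨J, hJ⟩ := eventually_atTop.1 (l1.and (l2.and (l3.and l4)))
    refine irrationalityExponent_le hb (N₀ := qd θ (J + K + 1 + 1)) fun N hN => ?_
    obtain ⟨j, hj, hj1, hj2⟩ := h.exists_cover hN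
    obtain ⟨D, E, h1, h2, h3, k, hk, h4⟩ :=
      h.exists_sharp_cover hc hb (by omega) (hq2 _ (by omega)) hj1 hj2
    have hratio : 0 < D → 1 + (E : ℝ) / D < μ → (D : ℝ) + E ≤ μ * D := by
      intro hD hlt
      have hD' : (0 : ℝ) < D := by exact_mod_cast hD
      have := mul_lt_mul_of_pos_right hlt hD'
      rw [add_mul, div_mul_cancel₀ _ hD'.ne', one_mul] at this
      exact this.le
    have hr2 := h.rn_pos (k := k + 2) (by omega)
    have hq1 := h.qd_pos (k + 1)
    obtain ⟨J1, J2, J3, -⟩ := hJ (k + 1) (by omega)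
    obtain ⟨-, -, -, J4⟩ := hJ k (by omega)
    rw [h.nuSeq₁_eq (by omega)] at J1
    rw [h.nuSeq₂_eq (by omega)] at J2
    rw [h.nuSeq₃_eq (by omega)] at J3
    rw [h.nuSeq₄_eq (by omega)] at J4
    simp only [add_assoc, Nat.reduceAdd, Set.mem_ofPred_eq, EReal.coe_lt_coe_iff] at J1 J2 J3 J4
    refine ⟨D, E, ?_, h1, h2, ?_, h3⟩
    · rcases h4 with ⟨-, -, hD, -⟩ | ⟨-, hD, -⟩ | ⟨hD, -⟩ | ⟨hD, -⟩ <;> omega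
    · rcases h4 with ⟨hd, hd', rfl, rfl⟩ | ⟨hd, rfl, rfl⟩ | ⟨rfl, rfl⟩ | ⟨rfl, rfl⟩
      · exact hratio (by omega) (J1 ⟨by omega, by omega⟩)
      · exact hratio (by omega) (J2 (by omega))
      · exact hratio (by omega) J3
      · exact hratio (by omega) J4
  · refine max_le (max_le ?_ ?_) (max_le ?_ ?_)
    · refine limsup_le_irrationalityExponent hb hirr (D := fun k => rn θ d (k + 1))
        (E := fun k => rn θ d (k + 1) + tk θ d k) (htend hinf ?_) ?_ ?_
      · filter_upwards [hge hinf, mem_inf_of_right (mem_principal_self _)] with k ⟨j, hj, hjK⟩ hk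
        subst hj
        simp only [add_assoc, Nat.reduceAdd] at *
        have := h.le_rn (k := j) (by omega) (by omega)
        omega
      · filter_upwards [hge hinf] with k ⟨j, hj, hjK⟩
        exact (h.nuSeq₁_eq (by omega)).le
      · filter_upwards [hge hinf, mem_inf_of_right (mem_principal_self _)] with k ⟨j, hj, hjK⟩ hk
        subst hj
        simp only [add_assoc, Nat.reduceAdd] at *
        exact Or.inr (h.sharp_short hc hb (by omega) (by omega) (by omega)).isApprox
    · refine limsup_le_irrationalityExponent hb hirr (D := fun k => rn θ d (k + 1) + tk θ d k)
        (E := fun k => rn θ d (k + 1) + qd θ k) (htend hinf ?_) ?_ ?_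
      · filter_upwards [hge hinf] with k ⟨j, hj, hjK⟩
        subst hj
        have := h.le_rn_add_tk (k := j) (by omega)
        simp only [add_assoc, Nat.reduceAdd] at *
        omega
      · filter_upwards [hge hinf] with k ⟨j, hj, hjK⟩
        exact (h.nuSeq₂_eq (by omega)).le
      · filter_upwards [hge hinf, mem_inf_of_right (mem_principal_self _)] with k ⟨j, hj, hjK⟩ hk
        subst hj
        simp only [add_assoc, Nat.reduceAdd] at *
        exact h.le_or_approx_long hc hb (by omega) (by omega)
    · refine limsup_le_irrationalityExponent hb hirr (D := fun k => rn θ d (k + 1) + qd θ k)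
        (E := fun k => qd θ (k + 1)) (htend le_rfl ?_) ?_ ?_
      · filter_upwards with k
        have := le_qd h.irrational h.slope_nonneg h.slope_lt_one k
        omega
      · filter_upwards [hge le_rfl] with k ⟨j, hj, hjK⟩
        exact (h.nuSeq₃_eq (by omega)).le
      · filter_upwards [hge le_rfl] with k ⟨j, hj, hjK⟩
        subst hj
        exact h.le_or_approx_preperiodic hc hb (by omega) (hq2 _ (by omega))
    · refine limsup_le_irrationalityExponent hb hirr (D := fun k => qd θ (k + 1))
        (E := fun k => rn θ d (k + 2)) (htend le_rfl ?_) ?_ ?_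
      · filter_upwards with k
        have := le_qd h.irrational h.slope_nonneg h.slope_lt_one (k + 1)
        omega
      · filter_upwards [hge le_rfl] with k ⟨j, hj, hjK⟩
        exact (h.nuSeq₄_eq (by omega)).le
      · filter_upwards [hge le_rfl] with k ⟨j, hj, hjK⟩
        exact h.le_or_approx_convergent hc hb (by omega)

end IsCoding

end Sturmian

namespace Sturmian

variable {pos : ℝ → Prop} {Φ : ℝ → ℤ} {θ σ : ℝ} {d : ℕ → ℕ}

/-! ### Codings from Ostrowski expansions -/

theorem OstrowskiRules.le_pq (h : OstrowskiRules θ d) (k : ℕ) : d (k + 1) ≤ pq θ (k + 1) := by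
  cases k with
  | zero => exact h.first.le
  | succ k => exact h.le _ (by omega)

theorem OstrowskiRules.tk_lt (h : OstrowskiRules θ d) (k : ℕ) : tk θ d k < qd θ k := by
  induction k using Nat.strong_induction_on with
  | _ k ih =>
    match k with
    | 0 => simp [tk, qd]
    | 1 => simpa [tk, qd] using h.first
    | k + 2 =>
      have e := tk_succ θ d (k + 1)
      have ih1 := ih (k + 1) (by omega)
      rcases (h.le_pq (k + 1)).lt_or_eq with hlt | heq
      · have : (d (k + 2) + 1) * qd θ (k + 1) ≤ pq θ (k + 2) * qd θ (k + 1) :=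
          Nat.mul_le_mul_right _ hlt
        rw [add_mul, one_mul] at this
        simp only [add_assoc, Nat.reduceAdd, qd] at *
        omega
      · have hz := h.zero (k + 1) (by omega) heq
        have e' := tk_succ θ d k
        have ih0 := ih k (by omega)
        rw [hz, zero_mul] at e'
        simp only [add_assoc, Nat.reduceAdd, qd] at *
        rw [heq] at e
        omega

theorem sum_digits_mul_theta (θ : ℝ) (d : ℕ → ℕ) (k : ℕ) :
    ∑ j ∈ Finset.range k, (d (j + 1) : ℝ) * thetaSeq θ j =
      tk θ d k * θ - ((∑ j ∈ Finset.range k, (d (j + 1) : ℤ) * pn θ j : ℤ) : ℝ) := by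
  simp only [tk, thetaSeq]
  push_cast
  rw [Finset.sum_mul, ← Finset.sum_sub_distrib]
  exact Finset.sum_congr rfl fun j _ => by ring

/-- The digits of an Ostrowski expansion of `σ` are a coding as soon as `σ` is not of the form
`g - mθ` with `m ≥ 1`. -/
theorem IsOstrowskiExpansion.isCoding (hd : IsOstrowskiExpansion θ σ d) (hc : IsRounding pos Φ)
    (hθ : Irrational θ) (h0 : 0 ≤ θ) (h1 : θ < 1)
    (hreg : ∀ m g : ℤ, 1 ≤ m → (m : ℝ) * θ + σ ≠ g) :
    IsCoding pos θ σ d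
      (fun k => pn θ k - ∑ j ∈ Finset.range k, (d (j + 1) : ℤ) * pn θ j) 0 where
  irrational := hθ
  slope_nonneg := h0
  slope_lt_one := h1
  le k _ := hd.le_pq k
  zero k _ := hd.zero (k + 1) (by omega)
  tk_lt k _ := hd.tk_lt k
  s_succ k := by rw [Finset.sum_range_succ]; ring
  side k _ := by
    have ht := hd.tk_lt k
    have hrk : 1 ≤ rk θ d k := by rw [rk]; omega
    -- the tail of the expansion is at least `-θ_k` in the direction of `(-1)^k`
    have hpart : ∀ i : ℕ, tau θ (k + 2 * i) ≤ (-1) ^ k * (thetaSeq θ k +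
        ∑ j ∈ Finset.range (k + 2 * i), (d (j + 1) : ℝ) * thetaSeq θ j -
        ∑ j ∈ Finset.range k, (d (j + 1) : ℝ) * thetaSeq θ j) := by
      intro i
      induction i with
      | zero => simp [tau]
      | succ i ih =>
        rw [show k + 2 * (i + 1) = k + 2 * i + 1 + 1 by ring, Finset.sum_range_succ,
          Finset.sum_range_succ]
        have e0 : (-1) ^ k * thetaSeq θ (k + 2 * i) = tau θ (k + 2 * i) := by
          rw [tau, pow_add, pow_mul]; norm_num
        have e1 : (-1) ^ k * thetaSeq θ (k + 2 * i + 1) = -tau θ (k + 2 * i + 1) := by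
          rw [tau, pow_add, pow_add, pow_mul]; norm_num
        have hrec := tau_rec θ (k + 2 * i)
        have hle : (d (k + 2 * i + 1 + 1) : ℝ) ≤ pq θ (k + 2 * i + 2) := by
          exact_mod_cast hd.le_pq (k + 2 * i + 1)
        have hm := mul_le_mul_of_nonneg_right hle (tau_pos hθ h0 h1 (k + 2 * i + 1)).le
        have hm0 := mul_nonneg (Nat.cast_nonneg (α := ℝ) (d (k + 2 * i + 1)))
          (tau_pos hθ h0 h1 (k + 2 * i)).le
        have hsplit : ∀ A B D x y : ℝ, (-1 : ℝ) ^ k * (A + (B + x + y) - D) =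
          (-1) ^ k * (A + B - D) + (-1) ^ k * x + (-1) ^ k * y := fun A B D x y => by ring
        rw [hsplit, mul_left_comm, e0, mul_left_comm ((-1 : ℝ) ^ k), e1]
        linarith
    have hpoint : ((rk θ d k : ℤ) : ℝ) * θ + σ -
        ((pn θ k - ∑ j ∈ Finset.range k, (d (j + 1) : ℤ) * pn θ j : ℤ) : ℝ) =
        thetaSeq θ k + σ - ∑ j ∈ Finset.range k, (d (j + 1) : ℝ) * thetaSeq θ j := by
      rw [sum_digits_mul_theta, rk, thetaSeq]; push_cast; ring
    have hlim : Tendsto (fun i : ℕ => (-1) ^ k * (thetaSeq θ k +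
        ∑ j ∈ Finset.range (k + 2 * i), (d (j + 1) : ℝ) * thetaSeq θ j -
        ∑ j ∈ Finset.range k, (d (j + 1) : ℝ) * thetaSeq θ j)) atTop
        (nhds ((-1) ^ k * (thetaSeq θ k + σ -
          ∑ j ∈ Finset.range k, (d (j + 1) : ℝ) * thetaSeq θ j))) := by
      refine Tendsto.const_mul _ (Tendsto.sub_const (Tendsto.const_add _ ?_) _)
      exact hd.hasSum.tendsto_sum_nat.comp
        (tendsto_atTop_mono (fun i => by omega : ∀ i : ℕ, i ≤ k + 2 * i) tendsto_id)
    have hnn := ge_of_tendsto' hlim fun i => (tau_pos hθ h0 h1 _).le.trans (hpart i)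
    refine hc.side_of_pos (lt_of_le_of_ne (by rw [hpoint]; exact hnn) (Ne.symm ?_))
    exact mul_ne_zero (pow_ne_zero _ (by norm_num)) (sub_ne_zero.2 (hreg _ _ hrk))

/-! ### Codings of the backward orbit of the origin -/

/-- From the rank `j` on, the digits are `0, a_{j+2}, 0, a_{j+4}, …`, and the orbit of `σ` is at `0`
at the time `r_j`. -/
structure IsBoundary (θ σ : ℝ) (d : ℕ → ℕ) (j : ℕ) : Prop where
  even : ∀ i, d (j + 2 * i + 1) = 0
  odd : ∀ i, d (j + 2 * i + 2) = pq θ (j + 2 * i + 2)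
  time : ∃ (m : ℕ) (p : ℤ), 1 ≤ m ∧ tk θ d j + m = qd θ j ∧ (m : ℝ) * θ + σ = p

/-- Boundary digits are a coding, provided that the origin is on the side `(-1)^j`. -/
theorem IsBoundary.exists_isCoding {j : ℕ} (h : IsBoundary θ σ d j) (hc : IsRounding pos Φ)
    (hθ : Irrational θ) (h0 : 0 ≤ θ) (h1 : θ < 1) (hs : Side pos j 0) :
    ∃ s, IsCoding pos θ σ d s j := by
  obtain ⟨m, p, hm, hmj, hmp⟩ := h.time
  let S : ℕ → ℤ := fun k => ∑ i ∈ Finset.range k, (d (i + 1) : ℤ) * pn θ i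
  let s : ℕ → ℤ := fun k => pn θ k - S k + (p - pn θ j + S j)
  have hss : ∀ k, s (k + 1) = s k + pn θ (k + 1) - (1 + d (k + 1)) * pn θ k := fun k => by
    simp only [s, S]; rw [Finset.sum_range_succ]; ring
  have hdich : ∀ k, j ≤ k → (∃ i, k = j + 2 * i) ∨ ∃ i, k = j + 2 * i + 1 := fun k hk => by
    rcases Nat.even_or_odd' (k - j) with ⟨i, hi | hi⟩
    · exact Or.inl ⟨i, by omega⟩
    · exact Or.inr ⟨i, by omega⟩
  have htk : ∀ i, tk θ d (j + 2 * i) + m = qd θ (j + 2 * i) := fun i => by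
    induction i with
    | zero => simpa using hmj
    | succ i ih =>
      have e1 := tk_succ θ d (j + 2 * i)
      have e2 := tk_succ θ d (j + 2 * i + 1)
      have h2 := h.odd i
      simp only [add_assoc, Nat.reduceAdd] at *
      rw [h2] at e2
      rw [← add_assoc, h.even, zero_mul] at e1
      rw [show 2 * (i + 1) = 2 * i + 2 by ring, ← add_assoc, qd]
      simp only [add_assoc] at *
      omega
  have hs_eq : ∀ i, s (j + 2 * i) = p := fun i => by
    induction i with
    | zero => simp only [s, mul_zero, add_zero]; ring
    | succ i ih =>
      have e1 := hss (j + 2 * i)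
      have e2 := hss (j + 2 * i + 1)
      have h2 := h.odd i
      rw [h.even, ih] at e1
      rw [show j + 2 * i + 1 + 1 = j + 2 * i + 2 by ring, h2, e1, pn] at e2
      rw [show j + 2 * (i + 1) = j + 2 * i + 2 by ring, e2]
      push_cast; ring
  have htk' : ∀ i, tk θ d (j + 2 * i + 1) + m = qd θ (j + 2 * i) := fun i => by
    have e1 := tk_succ θ d (j + 2 * i)
    rw [h.even, zero_mul] at e1
    have := htk i
    omega
  refine ⟨s, hθ, h0, h1, fun k hk => ?_, fun k hk hd => ?_, fun k hk => ?_, hss, fun k hk => ?_⟩ <;>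
  rcases hdich k hk with ⟨i, rfl⟩ | ⟨i, rfl⟩
  · rw [h.even]; omega
  · exact (h.odd i).le
  · exact h.even i
  · have h3 := h.even (i + 1)
    have h4 := pq_pos hθ h0 h1 (j + 2 * i + 2)
    rw [show j + 2 * (i + 1) + 1 = j + 2 * i + 1 + 2 by ring] at h3
    rw [show j + 2 * i + 2 + 1 = j + 2 * i + 1 + 2 by ring] at h4
    omega
  · have := htk i; omega
  · have := htk' i
    have := qd_le_succ hθ h0 h1 (j + 2 * i)
    omega
  · have hr : rk θ d (j + 2 * i) = m := by have := htk i; rw [rk]; omega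
    rw [hs_eq, hr]
    push_cast
    rw [hmp, sub_self]
    clear hs_eq hr
    induction i with
    | zero => exact hs
    | succ i ih =>
      rw [show j + 2 * (i + 1) = j + 2 * i + 2 by ring, side_add_two]
      exact ih (by omega)
  · apply hc.side_of_pos
    have hr : (rk θ d (j + 2 * i + 1) : ℤ) = qd θ (j + 2 * i + 1) - qd θ (j + 2 * i) + m := by
      have := htk' i; rw [rk]; omega
    rw [hss, hs_eq, hr, h.even]
    have e : (((qd θ (j + 2 * i + 1) - qd θ (j + 2 * i) + m : ℤ)) : ℝ) * θ + σ -
        ((p + pn θ (j + 2 * i + 1) - (1 + (0 : ℕ)) * pn θ (j + 2 * i) : ℤ) : ℝ) =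
        thetaSeq θ (j + 2 * i + 1) - thetaSeq θ (j + 2 * i) := by
      simp only [thetaSeq]; push_cast; linear_combination hmp
    rw [e, thetaSeq_eq, thetaSeq_eq, mul_sub, ← mul_assoc, ← mul_assoc, ← mul_pow, ← pow_add,
      show j + 2 * i + 1 + (j + 2 * i) = 2 * (j + 2 * i) + 1 by ring, pow_succ _ (2 * _), pow_mul]
    have t1 := tau_pos hθ h0 h1 (j + 2 * i + 1)
    have t0 := tau_pos hθ h0 h1 (j + 2 * i)
    norm_num
    linarith

/-- The two digit sequences attached to a point of the backward orbit of the origin end at ranks of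
opposite parity. -/
theorem IsDigitPair.isBoundary {ρ : ℝ} {l : ℕ} {e e' : ℕ → ℕ} (h : IsDigitPair θ ρ l e e')
    (hθ : Irrational θ) (h0 : 0 ≤ θ) (h1 : θ < 1) :
    (∃ j, (Even j ↔ Odd l) ∧ IsBoundary θ (ρ - θ) e j) ∧
      ∃ j, (Even j ↔ Even l) ∧ IsBoundary θ (ρ - θ) e' j := by
  cases h with
  | zero hρ =>
    refine ⟨⟨1, by decide, fun i => ?_, fun i => ?_, 1, 0, le_rfl, ?_, ?_⟩,
      ⟨0, by decide, fun i => ?_, fun i => ?_, 1, 0, le_rfl, ?_, ?_⟩⟩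
    · simp only [zeroDigits]
      rw [if_neg (by omega), if_pos ⟨i + 1, by ring⟩]
    · simp only [zeroDigits]
      rw [if_neg (by omega), if_neg (by rw [Nat.not_even_iff_odd]; exact ⟨i + 1, by ring⟩)]
    · have := pq_pos hθ h0 h1 0
      simp only [zero_add] at this
      simp [tk, zeroDigits, qd]; omega
    · simp [hρ]
    · simp only [zeroDigits']
      rw [if_neg (by rw [Nat.not_even_iff_odd]; exact ⟨i, by ring⟩)]
    · simp only [zeroDigits']
      rw [if_pos ⟨i + 1, by ring⟩]
    · simp [tk, qd]
    · simp [hρ]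
  | pos m p l c hm hρ hl hl' hc =>
    have hsum := hc.sum_eq
    have hmp : (m : ℝ) * θ + (ρ - θ) = p := by rw [hρ]; ring
    refine ⟨⟨l + 1, by grind, fun i => ?_, fun i => ?_, m, p, by omega, ?_, hmp⟩,
      ⟨l + 2, by grind, fun i => ?_, fun i => ?_, m, p, by omega, ?_, hmp⟩⟩
    · simp only [tailDigits]
      rw [if_neg (by omega), if_pos ⟨i + 1, by omega⟩]
    · simp only [tailDigits]
      rw [if_neg (by omega), if_neg (by rw [Nat.not_even_iff_odd]; exact ⟨i + 1, by omega⟩)]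
    · have : tk θ (tailDigits θ l c) (l + 1) =
          ∑ j ∈ Finset.range (l + 1), c (j + 1) * qd θ j := by
        refine Finset.sum_congr rfl fun j hj => ?_
        have := Finset.mem_range.1 hj
        rw [tailDigits, if_pos (by omega)]
      omega
    · simp only [tailDigits']
      rw [if_neg (by omega), if_neg (by omega), if_neg (by omega),
        if_neg (by rw [Nat.not_even_iff_odd]; exact ⟨i + 1, by omega⟩)]
    · simp only [tailDigits']
      rw [if_neg (by omega), if_neg (by omega), if_neg (by omega), if_pos ⟨i + 2, by omega⟩]
    · have h3 : tk θ (tailDigits' θ l c) l = ∑ j ∈ Finset.range l, c (j + 1) * qd θ j := by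
        refine Finset.sum_congr rfl fun j hj => ?_
        have := Finset.mem_range.1 hj
        rw [tailDigits', if_pos (by omega)]
      have h4 : tailDigits' θ l c (l + 1) = c (l + 1) + 1 := by simp [tailDigits']
      have h5 : tailDigits' θ l c (l + 2) = pq θ (l + 2) - 1 := by simp [tailDigits']
      rw [Finset.sum_range_succ] at hsum
      rw [tk_succ, tk_succ, h3, h4, h5, qd]
      obtain ⟨a, ha⟩ : ∃ a, pq θ (l + 2) = a + 1 :=
        ⟨pq θ (l + 2) - 1, by have : 1 ≤ pq θ (l + 2) := pq_pos hθ h0 h1 (l + 1); omega⟩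
      rw [ha, Nat.add_sub_cancel, add_mul, add_mul, one_mul, one_mul]
      omega

end Sturmian

namespace Sturmian

variable {θ σ : ℝ}

/-! ### Existence of Ostrowski expansions -/

theorem exists_isOstrowskiNat (hθ : Irrational θ) (h0 : 0 ≤ θ) (h1 : θ < 1) (n : ℕ) :
    ∀ N < qd θ n, ∃ c, IsOstrowskiNat θ N n c := by
  have ha : ∀ k, 1 ≤ pq θ (k + 1) := pq_pos hθ h0 h1
  induction n with
  | zero =>
    intro N hN
    refine ⟨fun _ => 0, ⟨ha 0, fun _ _ => Nat.zero_le _, fun _ _ _ => rfl⟩, fun _ _ => rfl, ?_⟩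
    simpa [qd] using hN
  | succ n ih =>
    intro N hN
    have hq := qd_pos hθ h0 h1 n
    obtain ⟨c, hc⟩ := ih (N % qd θ n) (Nat.mod_lt _ hq)
    have hdm := Nat.div_add_mod N (qd θ n)
    have hmod := Nat.mod_lt N hq
    set e := N / qd θ n with he
    have hcn : ∀ k, k ≠ n + 1 → Function.update c (n + 1) e k = c k := fun k hk =>
      Function.update_of_ne hk _ _
    have hcs : Function.update c (n + 1) e (n + 1) = e := Function.update_self _ _ _
    have hle : e ≤ pq θ (n + 1) := by
      by_contra! hgt
      have h2 : (pq θ (n + 1) + 1) * qd θ n ≤ e * qd θ n := Nat.mul_le_mul_right _ hgt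
      rw [add_mul, one_mul, mul_comm e] at h2
      cases n with
      | zero => simp only [qd, zero_add] at *; omega
      | succ n =>
        have h3 := qd_le_succ hθ h0 h1 n
        rw [qd] at hN
        simp only [add_assoc, Nat.reduceAdd] at *
        omega
    -- if the leading digit is maximal, then the remainder is less than `q_{n-1}`
    have hzero : e = pq θ (n + 1) → 1 ≤ n → c n = 0 := by
      intro heq hn
      obtain ⟨n, rfl⟩ : ∃ i, n = i + 1 := ⟨n - 1, by omega⟩
      have h2 := hc.sum_eq
      rw [Finset.sum_range_succ] at h2
      rw [heq, mul_comm] at hdm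
      rw [qd] at hN
      by_contra hne
      have h4 : 1 * qd θ n ≤ c (n + 1) * qd θ n := Nat.mul_le_mul_right _ (by omega)
      simp only [add_assoc, Nat.reduceAdd] at *
      omega
    refine ⟨Function.update c (n + 1) e, ⟨?_, fun k hk => ?_, fun k hk hk' => ?_⟩,
      fun k hk => ?_, ?_⟩
    · cases n with
      | zero =>
        rw [zero_add, Function.update_self, he]
        simpa [qd] using hN
      | succ n => rw [hcn _ (by omega)]; exact hc.first
    · rcases eq_or_ne k (n + 1) with rfl | hne
      · rw [hcs]; exact hle
      · rw [hcn _ hne]; exact hc.le k hk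
    · rcases eq_or_ne k (n + 1) with rfl | hne
      · rw [hcn _ (by omega), hc.zero_of_lt _ (by omega)] at hk'
        have := ha (n + 1)
        omega
      · rw [hcn _ hne]
        rcases eq_or_ne k n with rfl | hne'
        · rw [hcs] at hk'
          exact hzero hk' hk
        · rw [hcn _ (by omega)] at hk'
          exact hc.zero k hk hk'
    · rw [hcn _ (by omega)]
      exact hc.zero_of_lt _ (by omega)
    · rw [Finset.sum_range_succ, hcs, mul_comm, ← hdm]
      have : ∑ j ∈ Finset.range n, Function.update c (n + 1) e (j + 1) * qd θ j =
          ∑ j ∈ Finset.range n, c (j + 1) * qd θ j :=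
        Finset.sum_congr rfl fun j hj => by
          have := Finset.mem_range.1 hj
          rw [hcn _ (by omega)]
      rw [this, ← hc.sum_eq, add_comm]

/-- The remainders of the greedy Ostrowski expansion of `σ`, multiplied by `(-1)^k`. The digit that
is removed at step `k` brings the remainder into an interval of length `|θ_k|`. -/
noncomputable def greedyRem (θ σ : ℝ) : ℕ → ℝ
  | 0 => σ
  | k + 1 => ⌊(greedyRem θ σ k + tau θ k - tau θ (k + 1)) / tau θ k⌋₊ * tau θ k - greedyRem θ σ k

/-- The digits of the greedy Ostrowski expansion of `σ`. -/
noncomputable def greedyDigit (θ σ : ℝ) (k : ℕ) : ℕ :=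
  ⌊(greedyRem θ σ (k - 1) + tau θ (k - 1) - tau θ k) / tau θ (k - 1)⌋₊

theorem greedyRem_succ (θ σ : ℝ) (k : ℕ) :
    greedyRem θ σ (k + 1) = greedyDigit θ σ (k + 1) * tau θ k - greedyRem θ σ k := rfl

theorem sum_greedyDigit (θ σ : ℝ) (k : ℕ) :
    ∑ j ∈ Finset.range k, (greedyDigit θ σ (j + 1) : ℝ) * thetaSeq θ j =
      σ - (-1) ^ k * greedyRem θ σ k := by
  induction k with
  | zero => simp [greedyRem]
  | succ k ih =>
    rw [Finset.sum_range_succ, ih, greedyRem_succ, thetaSeq_eq, pow_succ]; ring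

section greedy

variable (hθ : Irrational θ) (h0 : 0 ≤ θ) (h1 : θ < 1) (hσ : -θ < σ) (hσ' : σ < 1 - θ)
include hθ h0 h1

theorem greedyDigit_le (k : ℕ) (hpos : 1 ≤ greedyDigit θ σ (k + 1)) :
    greedyDigit θ σ (k + 1) * tau θ k ≤ greedyRem θ σ k + tau θ k - tau θ (k + 1) := by
  have ht := tau_pos hθ h0 h1 k
  have := (Nat.le_floor_iff' (by omega)).1 (le_refl (greedyDigit θ σ (k + 1)))
  rwa [Nat.add_sub_cancel, le_div_iff₀ ht] at this

theorem lt_greedyDigit (k : ℕ) :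
    greedyRem θ σ k - tau θ (k + 1) < greedyDigit θ σ (k + 1) * tau θ k := by
  have ht := tau_pos hθ h0 h1 k
  have := Nat.lt_floor_add_one ((greedyRem θ σ k + tau θ k - tau θ (k + 1)) / tau θ k)
  rw [div_lt_iff₀ ht] at this
  change _ < ((greedyDigit θ σ (k + 1) : ℝ) + 1) * tau θ k at this
  linarith

include hσ hσ'

/-- The remainder stays between `-|θ_k|` and `|θ_{k-1}| = a_{k+1} |θ_k| + |θ_{k+1}|`. For `k = 0`,
the better bound `1 - θ = (a_1 - 1) |θ_0| + |θ_1|` accounts for the special rule on the first digit. -/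
theorem greedyRem_bounds (k : ℕ) : -tau θ k < greedyRem θ σ k ∧
    greedyRem θ σ k < pq θ (k + 1) * tau θ k + tau θ (k + 1) ∧
    (k = 0 → greedyRem θ σ k < (pq θ (k + 1) - 1) * tau θ k + tau θ (k + 1)) := by
  induction k with
  | zero =>
    have h2 := tau_one θ
    rw [tau_zero] at *
    simp only [greedyRem, zero_add]
    refine ⟨hσ, by linarith, fun _ => by linarith⟩
  | succ k ih =>
    have hl := lt_greedyDigit (σ := σ) hθ h0 h1 k
    have hr := tau_rec θ k
    have ht := tau_pos hθ h0 h1 (k + 1)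
    refine ⟨by rw [greedyRem_succ]; linarith, ?_, by omega⟩
    simp only [add_assoc, Nat.reduceAdd]
    rw [← hr, greedyRem_succ]
    rcases Nat.eq_zero_or_pos (greedyDigit θ σ (k + 1)) with hz | hz
    · rw [hz]; push_cast; linarith
    · have := greedyDigit_le hθ h0 h1 k hz
      linarith

theorem greedyDigit_le_pq (k : ℕ) : greedyDigit θ σ (k + 1) ≤ pq θ (k + 1) := by
  by_contra! hgt
  have h2 := greedyDigit_le (σ := σ) hθ h0 h1 k (by omega)
  have h3 := (greedyRem_bounds hθ h0 h1 hσ hσ' k).2.1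
  have ht := tau_pos hθ h0 h1 k
  have h4 : (pq θ (k + 1) : ℝ) + 1 ≤ greedyDigit θ σ (k + 1) := by exact_mod_cast hgt
  nlinarith

theorem greedyDigit_one_lt : greedyDigit θ σ 1 < pq θ 1 := by
  by_contra! hge
  have h2 := greedyDigit_le (σ := σ) hθ h0 h1 0 ((pq_pos hθ h0 h1 0).trans hge)
  have h3 := (greedyRem_bounds hθ h0 h1 hσ hσ' 0).2.2 rfl
  have ht := tau_pos hθ h0 h1 0
  have h4 : (pq θ 1 : ℝ) ≤ greedyDigit θ σ 1 := by exact_mod_cast hge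
  simp only [zero_add] at *
  nlinarith

/-- A bound on `t_{k+1}` that needs only `d_j ≤ a_j`: it is used in the proof of the Ostrowski
rules, from which the sharper bound `t_{k+1} < q_{k+1}` would follow. -/
theorem tk_greedyDigit_lt (k : ℕ) : tk θ (greedyDigit θ σ) (k + 1) < qd θ (k + 1) + qd θ k := by
  induction k using Nat.strong_induction_on with
  | _ k ih =>
    match k with
    | 0 =>
      have := greedyDigit_one_lt hθ h0 h1 hσ hσ'
      simp [tk, qd]; omega
    | k + 1 =>
      have ih' := ih k (by omega)
      have h2 : greedyDigit θ σ (k + 2) * qd θ (k + 1) ≤ pq θ (k + 2) * qd θ (k + 1) :=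
        Nat.mul_le_mul_right _ (greedyDigit_le_pq hθ h0 h1 hσ hσ' (k + 1))
      rw [tk_succ]
      simp only [add_assoc, Nat.reduceAdd, qd] at *
      omega

/-- The only obstruction to the Ostrowski rules is a tie in the choice of a digit, and a tie puts
`σ` into the backward orbit of the origin. -/
theorem ostrowskiRules_greedyDigit (hreg : ∀ m g : ℤ, 1 ≤ m → (m : ℝ) * θ + σ ≠ g) :
    OstrowskiRules θ (greedyDigit θ σ) where
  first := greedyDigit_one_lt hθ h0 h1 hσ hσ'
  le k hk := by
    obtain ⟨k, rfl⟩ : ∃ i, k = i + 1 := ⟨k - 1, by omega⟩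
    exact greedyDigit_le_pq hθ h0 h1 hσ hσ' k
  zero k hk hd := by
    obtain ⟨k, rfl⟩ : ∃ i, k = i + 1 := ⟨k - 1, by omega⟩
    by_contra hne
    have h2 := greedyDigit_le (σ := σ) hθ h0 h1 k (by omega)
    have h3 := greedyDigit_le (σ := σ) hθ h0 h1 (k + 1) (by
      rw [hd]; exact pq_pos hθ h0 h1 (k + 1))
    have h4 := greedyRem_succ θ σ k
    have h5 := tau_rec θ k
    rw [hd] at h3
    simp only [add_assoc, Nat.reduceAdd] at *
    have heq : greedyRem θ σ (k + 1) = tau θ k - tau θ (k + 1) := by linarith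
    have hsum := sum_greedyDigit θ σ (k + 1)
    rw [heq, sum_digits_mul_theta] at hsum
    have htk := tk_greedyDigit_lt hθ h0 h1 hσ hσ' k
    refine hreg ((qd θ (k + 1) : ℤ) + qd θ k - tk θ (greedyDigit θ σ) (k + 1))
      (pn θ (k + 1) + pn θ k -
        ∑ j ∈ Finset.range (k + 1), (greedyDigit θ σ (j + 1) : ℤ) * pn θ j) (by omega) ?_
    have e1 : (-1 : ℝ) ^ (k + 1) * tau θ (k + 1) = thetaSeq θ (k + 1) := (thetaSeq_eq _ _).symm
    have e0 : (-1 : ℝ) ^ k * tau θ k = thetaSeq θ k := (thetaSeq_eq _ _).symm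
    have e2 : (-1 : ℝ) ^ (k + 1) * (tau θ k - tau θ (k + 1)) =
        -thetaSeq θ k - thetaSeq θ (k + 1) := by
      rw [mul_sub, e1, ← e0, pow_succ]; ring
    rw [e2] at hsum
    simp only [thetaSeq] at hsum
    push_cast at hsum ⊢
    linarith

theorem hasSum_greedyDigit :
    HasSum (fun k : ℕ => (greedyDigit θ σ (k + 1) : ℝ) * thetaSeq θ k) σ := by
  have hbound : ∀ n : ℕ, ∑ j ∈ Finset.range (n + 1), (pq θ (j + 1) : ℝ) * tau θ j =
      1 + tau θ 0 - tau θ n - tau θ (n + 1) := by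
    intro n
    induction n with
    | zero =>
      have := tau_one θ
      rw [Finset.sum_range_one]
      simp only [zero_add]
      linarith
    | succ n ih =>
      have := tau_rec θ n
      rw [Finset.sum_range_succ, ih]
      simp only [add_assoc, Nat.reduceAdd]
      linarith
  have hsumm : Summable fun k : ℕ => (greedyDigit θ σ (k + 1) : ℝ) * thetaSeq θ k := by
    refine Summable.of_norm (summable_of_sum_range_le (c := 2) (fun _ => norm_nonneg _) fun n => ?_)
    have hnorm : ∀ j, ‖(greedyDigit θ σ (j + 1) : ℝ) * thetaSeq θ j‖ ≤ pq θ (j + 1) * tau θ j := by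
      intro j
      have ht := tau_pos hθ h0 h1 j
      rw [thetaSeq_eq, norm_mul, norm_mul, norm_pow, norm_neg, norm_one, one_pow, one_mul,
        Real.norm_natCast, Real.norm_of_nonneg ht.le]
      have : (greedyDigit θ σ (j + 1) : ℝ) ≤ pq θ (j + 1) := by
        exact_mod_cast greedyDigit_le_pq hθ h0 h1 hσ hσ' j
      gcongr
    have hterm : ∀ j, (0 : ℝ) ≤ pq θ (j + 1) * tau θ j := fun j =>
      mul_nonneg (Nat.cast_nonneg _) (tau_pos hθ h0 h1 j).le
    calc _ ≤ ∑ j ∈ Finset.range n, (pq θ (j + 1) : ℝ) * tau θ j :=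
          Finset.sum_le_sum fun j _ => hnorm j
      _ ≤ ∑ j ∈ Finset.range (n + 1), (pq θ (j + 1) : ℝ) * tau θ j :=
          Finset.sum_le_sum_of_subset_of_nonneg (Finset.range_subset_range.2 (by omega))
            fun j _ _ => hterm j
      _ ≤ 2 := by
          have := tau_pos hθ h0 h1 n
          have := tau_pos hθ h0 h1 (n + 1)
          have := tau_lt_one hθ h0 h1 0
          rw [hbound]; linarith
  rw [hsumm.hasSum_iff_tendsto_nat]
  simp only [sum_greedyDigit]
  have hz : Tendsto (fun k => (-1) ^ (k + 1) * greedyRem θ σ (k + 1)) atTop (nhds 0) := by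
    refine squeeze_zero_norm (fun k => ?_) (tendsto_tau hθ h0 h1)
    rw [norm_mul, norm_pow, norm_neg, norm_one, one_pow, one_mul, Real.norm_eq_abs, abs_le]
    obtain ⟨b1, b2, -⟩ := greedyRem_bounds hθ h0 h1 hσ hσ' (k + 1)
    have := tau_rec θ k
    have := tau_succ_lt hθ h0 h1 k
    simp only [add_assoc, Nat.reduceAdd] at *
    constructor <;> linarith
  have hz' := (tendsto_add_atTop_iff_nat (f := fun k => (-1) ^ k * greedyRem θ σ k) 1).1 hz
  simpa using hz'.const_sub σ

/-- The greedy digits do not end with maximal digits at every other place: the remainder would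
be `-θ_j` at some step. -/
theorem not_tail_greedyDigit (j : ℕ) : ¬ ∀ i, greedyDigit θ σ (j + 2 * i + 1) = 0 ∧
    greedyDigit θ σ (j + 2 * i + 2) = pq θ (j + 2 * i + 2) := by
  intro h
  have hconst : ∀ i, greedyRem θ σ (j + 2 * i) + tau θ (j + 2 * i) =
      greedyRem θ σ j + tau θ j := by
    intro i
    induction i with
    | zero => simp
    | succ i ih =>
      have e1 := greedyRem_succ θ σ (j + 2 * i)
      have e2 := greedyRem_succ θ σ (j + 2 * i + 1)
      have e3 := tau_rec θ (j + 2 * i)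
      rw [(h i).1] at e1
      rw [show j + 2 * i + 1 + 1 = j + 2 * i + 2 by ring, (h i).2] at e2
      rw [show j + 2 * (i + 1) = j + 2 * i + 2 by ring, ← ih, e2, e1]
      push_cast
      linarith
  have hsub : Tendsto (fun i : ℕ => j + 2 * i) atTop atTop :=
    tendsto_atTop_mono (fun i => by omega : ∀ i : ℕ, i ≤ j + 2 * i) tendsto_id
  have hrem : Tendsto (greedyRem θ σ) atTop (nhds 0) := by
    have hz := (tendsto_add_atTop_iff_nat (f := greedyRem θ σ) 1).1
      (squeeze_zero_norm (fun k => ?_) (tendsto_tau hθ h0 h1))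
    · exact hz
    · rw [Real.norm_eq_abs, abs_le]
      obtain ⟨b1, b2, -⟩ := greedyRem_bounds hθ h0 h1 hσ hσ' (k + 1)
      have := tau_rec θ k
      have := tau_succ_lt hθ h0 h1 k
      simp only [add_assoc, Nat.reduceAdd] at *
      constructor <;> linarith
  have hlim := (hrem.comp hsub).add ((tendsto_tau hθ h0 h1).comp hsub)
  simp only [Function.comp_def, hconst, add_zero] at hlim
  have := tendsto_nhds_unique hlim tendsto_const_nhds
  have := (greedyRem_bounds hθ h0 h1 hσ hσ' j).1
  linarith

theorem isOstrowskiExpansion_greedyDigit (hreg : ∀ m g : ℤ, 1 ≤ m → (m : ℝ) * θ + σ ≠ g) :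
    IsOstrowskiExpansion θ σ (greedyDigit θ σ) := by
  have hrules := ostrowskiRules_greedyDigit hθ h0 h1 hσ hσ' hreg
  have key : ∀ n, ∃ i, greedyDigit θ σ (n + 2 * i + 2) < pq θ (n + 2 * i + 2) := by
    intro n
    by_contra! hc
    refine not_tail_greedyDigit hθ h0 h1 hσ hσ' n fun i => ?_
    have heq := le_antisymm (hrules.le_pq (n + 2 * i + 1)) (hc i)
    exact ⟨hrules.zero _ (by omega) heq, heq⟩
  refine ⟨hrules, hasSum_greedyDigit hθ h0 h1 hσ hσ', ?_, ?_⟩ <;>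
  refine Set.infinite_of_forall_exists_gt fun n => ?_
  · obtain ⟨i, hi⟩ := key (2 * n + 1)
    exact ⟨_, ⟨⟨n + i + 1, by ring⟩, hi⟩, by omega⟩
  · obtain ⟨i, hi⟩ := key (2 * n)
    exact ⟨_, ⟨⟨n + i + 1, by ring⟩, hi⟩, by omega⟩

end greedy

end Sturmian

namespace Sturmian

variable {pos : ℝ → Prop} {Φ : ℝ → ℤ} {θ ρ : ℝ}

/-! ### Sturmian numbers -/

/-- A regular intercept is not in the backward orbit of the origin. -/
theorem IsRegularIntercept.ne (h : IsRegularIntercept θ ρ) (hθ : Irrational θ) (m g : ℤ)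
    (hm : 1 ≤ m) : (m : ℝ) * θ + (ρ - θ) ≠ g := by
  intro heq
  rcases h with h | ⟨m', p, hm', h⟩
  · exact h ⟨1 - m, g, by push_cast; linarith⟩
  · have h2 : ((m + m' - 1 : ℤ) : ℝ) * θ = ((g - p : ℤ) : ℝ) := by
      push_cast; linear_combination heq - h
    exact (hθ.intCast_mul (by omega : m + m' - 1 ≠ 0)).ne_int _ h2

theorem exists_isDigitPair (h : ¬ IsRegularIntercept θ ρ) (hθ : Irrational θ) (h0 : 0 ≤ θ)
    (h1 : θ < 1) (hρ0 : 0 ≤ ρ) (hρ1 : ρ < 1) : ∃ l e e', IsDigitPair θ ρ l e e' := by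
  obtain ⟨hmem, hne⟩ := not_or.1 h
  obtain ⟨m, p, hmp⟩ := not_not.1 hmem
  have hm : m ≤ 0 := by
    by_contra! hc
    exact hne ⟨m, p, by omega, hmp⟩
  rcases hm.lt_or_eq with hlt | rfl
  · obtain ⟨n, hn⟩ : ∃ n : ℕ, (n : ℤ) = 1 - m := ⟨(1 - m).toNat, by omega⟩
    have hn2 : 2 ≤ n := by omega
    have hex : ∃ l, n ≤ qd θ (l + 1) := ⟨n, (by omega : n ≤ n + 1).trans (le_qd hθ h0 h1 _)⟩
    classical
    have hl := Nat.find_spec hex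
    have hl' : qd θ (Nat.find hex) < n := by
      rcases Nat.eq_zero_or_pos (Nat.find hex) with hz | hz
      · rw [hz, qd]; omega
      · have := Nat.find_min hex (m := Nat.find hex - 1) (by omega)
        rw [Nat.sub_add_cancel hz] at this
        omega
    obtain ⟨c, hc⟩ := exists_isOstrowskiNat hθ h0 h1 (Nat.find hex + 1)
      (qd θ (Nat.find hex + 1) - n) (by omega)
    refine ⟨_, _, _, IsDigitPair.pos n p _ c hn2 ?_ hl' hl hc⟩
    have : (n : ℝ) = 1 - m := by exact_mod_cast hn
    rw [this, hmp]; ring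
  · have hp : ρ = 0 := by
      simp only [Int.cast_zero, zero_mul, zero_add] at hmp
      rw [hmp] at hρ0 hρ1 ⊢
      have h2 : 0 ≤ p := by exact_mod_cast hρ0
      have h3 : p < 1 := by exact_mod_cast hρ1
      have : p = 0 := by omega
      simp [this]
    exact ⟨_, _, _, IsDigitPair.zero hp⟩

theorem exists_expansion (h : IsRegularIntercept θ ρ) (hθ : Irrational θ) (h0 : 0 ≤ θ)
    (h1 : θ < 1) (hρ0 : 0 ≤ ρ) (hρ1 : ρ < 1) : ∃ d, IsOstrowskiExpansion θ (ρ - θ) d := by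
  refine ⟨_, isOstrowskiExpansion_greedyDigit hθ h0 h1 ?_ (by linarith) (h.ne hθ)⟩
  have hne := h.ne hθ 1 0 le_rfl
  have : ρ ≠ 0 := fun hz => hne (by rw [hz]; simp)
  have := lt_of_le_of_ne hρ0 (Ne.symm this)
  linarith

theorem roundingNumber_floor (b : ℕ) (θ ρ : ℝ) :
    roundingNumber b (fun x => ⌊x⌋) θ (ρ - θ) = xiLower b θ ρ := by
  rw [roundingNumber, xiLower]
  congr 1
  refine tsum_congr fun n => ?_
  have e1 : ((n + 2 : ℕ) : ℝ) * θ + (ρ - θ) = ((n + 1 : ℕ) : ℝ) * θ + ρ := by push_cast; ring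
  have e2 : ((n + 1 : ℕ) : ℝ) * θ + (ρ - θ) = (((n + 1 : ℕ) : ℝ) - 1) * θ + ρ := by
    push_cast; ring
  rw [lowerLetter, ← e1, ← e2]

theorem roundingNumber_ceil (b : ℕ) (θ ρ : ℝ) :
    roundingNumber b (fun x => ⌈x⌉ - 1) θ (ρ - θ) = xiUpper b θ ρ := by
  rw [roundingNumber, xiUpper]
  congr 1
  refine tsum_congr fun n => ?_
  have e1 : ((n + 2 : ℕ) : ℝ) * θ + (ρ - θ) = ((n + 1 : ℕ) : ℝ) * θ + ρ := by push_cast; ring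
  have e2 : ((n + 1 : ℕ) : ℝ) * θ + (ρ - θ) = (((n + 1 : ℕ) : ℝ) - 1) * θ + ρ := by
    push_cast; ring
  rw [upperLetter, sub_sub_sub_cancel_right, ← e1, ← e2]

theorem IsOstrowskiExpansion.irrationalityExponent_eq {b : ℕ} (hb : 2 ≤ b) {d : ℕ → ℕ}
    (hd : IsOstrowskiExpansion θ (ρ - θ) d) (hreg : IsRegularIntercept θ ρ)
    (hc : IsRounding pos Φ) (hθ : Irrational θ) (h0 : 0 ≤ θ) (h1 : θ < 1) :
    irrationalityExponent (roundingNumber b Φ θ (ρ - θ)) =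
      max (max (nu₁ θ d) (nu₂ θ d)) (max (nu₃ θ d) (nu₄ θ d)) :=
  (hd.isCoding hc hθ h0 h1 (hreg.ne hθ)).irrationalityExponent_eq hc hb

theorem IsBoundary.irrationalityExponent_eq {b : ℕ} (hb : 2 ≤ b) {d : ℕ → ℕ} {j : ℕ}
    (hd : IsBoundary θ (ρ - θ) d j) (hc : IsRounding pos Φ) (hs : Side pos j 0)
    (hθ : Irrational θ) (h0 : 0 ≤ θ) (h1 : θ < 1) :
    irrationalityExponent (roundingNumber b Φ θ (ρ - θ)) =
      max (max (nu₁ θ d) (nu₂ θ d)) (max (nu₃ θ d) (nu₄ θ d)) :=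
  let ⟨_, h⟩ := hd.exists_isCoding hc hθ h0 h1 hs
  h.irrationalityExponent_eq hc hb

end Sturmian

theorem theorem2p4 (b : ℕ) (hb : 2 ≤ b) (θ ρ : ℝ) (hθ : Irrational θ)
    (hθ0 : 0 ≤ θ) (hθ1 : θ < 1) (hρ0 : 0 ≤ ρ) (hρ1 : ρ < 1) :
    ((∃ d, Sturmian.IsLowerDigits θ ρ d) ∧
      ∀ d, Sturmian.IsLowerDigits θ ρ d →
        Sturmian.irrationalityExponent (Sturmian.xiLower b θ ρ) =
          max (max (Sturmian.nu₁ θ d) (Sturmian.nu₂ θ d))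
            (max (Sturmian.nu₃ θ d) (Sturmian.nu₄ θ d))) ∧
    ((∃ d, Sturmian.IsUpperDigits θ ρ d) ∧
      ∀ d, Sturmian.IsUpperDigits θ ρ d →
        Sturmian.irrationalityExponent (Sturmian.xiUpper b θ ρ) =
          max (max (Sturmian.nu₁ θ d) (Sturmian.nu₂ θ d))
            (max (Sturmian.nu₃ θ d) (Sturmian.nu₄ θ d))) := by
  open Sturmian in
  have hlow : ∀ j, Even j → Side (fun x : ℝ => 0 ≤ x) j 0 := fun j hj =>
    (side_even hj 0).2 le_rfl
  have hupp : ∀ j, ¬ Even j → Side (fun x : ℝ => 0 < x) j 0 := fun j hj =>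
    (side_odd (Nat.not_even_iff_odd.1 hj) 0).2 (lt_irrefl 0)
  refine ⟨⟨?_, fun d hd => ?_⟩, ⟨?_, fun d hd => ?_⟩⟩
  · by_cases h : IsRegularIntercept θ ρ
    · exact (exists_expansion h hθ hθ0 hθ1 hρ0 hρ1).imp fun d hd => Or.inl ⟨h, hd⟩
    · obtain ⟨l, e, e', hp⟩ := exists_isDigitPair h hθ hθ0 hθ1 hρ0 hρ1
      rcases Nat.even_or_odd l with hl | hl
      · exact ⟨e', Or.inr ⟨l, e, e', hp, Or.inr ⟨hl, rfl⟩⟩⟩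
      · exact ⟨e, Or.inr ⟨l, e, e', hp, Or.inl ⟨hl, rfl⟩⟩⟩
  · rw [← roundingNumber_floor]
    rcases hd with ⟨hreg, hd⟩ | ⟨l, e, e', hp, hd⟩
    · exact hd.irrationalityExponent_eq hb hreg isRounding_floor hθ hθ0 hθ1
    · obtain ⟨⟨j, hj, hB⟩, j', hj', hB'⟩ := hp.isBoundary hθ hθ0 hθ1
      rcases hd with ⟨hl, rfl⟩ | ⟨hl, rfl⟩
      · exact hB.irrationalityExponent_eq hb isRounding_floor (hlow _ (hj.2 hl)) hθ hθ0 hθ1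
      · exact hB'.irrationalityExponent_eq hb isRounding_floor (hlow _ (hj'.2 hl)) hθ hθ0 hθ1
  · by_cases h : IsRegularIntercept θ ρ
    · exact (exists_expansion h hθ hθ0 hθ1 hρ0 hρ1).imp fun d hd => Or.inl ⟨h, hd⟩
    · obtain ⟨l, e, e', hp⟩ := exists_isDigitPair h hθ hθ0 hθ1 hρ0 hρ1
      rcases Nat.even_or_odd l with hl | hl
      · exact ⟨e, Or.inr ⟨l, e, e', hp, Or.inr ⟨hl, rfl⟩⟩⟩
      · exact ⟨e', Or.inr ⟨l, e, e', hp, Or.inl ⟨hl, rfl⟩⟩⟩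
  · rw [← roundingNumber_ceil]
    rcases hd with ⟨hreg, hd⟩ | ⟨l, e, e', hp, hd⟩
    · exact hd.irrationalityExponent_eq hb hreg isRounding_ceil hθ hθ0 hθ1
    · obtain ⟨⟨j, hj, hB⟩, j', hj', hB'⟩ := hp.isBoundary hθ hθ0 hθ1
      rcases hd with ⟨hl, rfl⟩ | ⟨hl, rfl⟩
      · exact hB'.irrationalityExponent_eq hb isRounding_ceil
          (hupp _ fun he => Nat.not_even_iff_odd.2 hl (hj'.1 he)) hθ hθ0 hθ1
      · exact hB.irrationalityExponent_eq hb isRounding_ceil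
          (hupp _ fun he => Nat.not_even_iff_odd.2 (hj.1 he) hl) hθ hθ0 hθ1
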